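/- Let $\overline{\mathbb Q}\subset\mathbb C$ be the algebraic closure of $\mathbb Q$ in $\mathbb C$, and let $L$ be $\mathbb Q$ or $\overline{\mathbb Q}$. Let $\mathscr C_L$ be the rigid tensor category whose objects are triples $M=(M_{\mathrm{dR}},M_{\mathrm B},c_M)$, where $M_{\mathrm{dR}}$ is a finite-dimensional $\overline{\mathbb Q}$-vector space, $M_{\mathrm B}$ is a finite-dimensional $L$-vector space and $c_M\colon M_{\mathrm{dR}}\otimes_{\overline{\mathbb Q}}\mathbb C\to M_{\mathrm B}\otimes_L\mathbb C$ is a $\mathbb C$-linear isomorphism; a morphism $M\to N$ is a pair consisting of a $\overline{\mathbb Q}$-linear map $M_{\mathrm{dR}}\to N_{\mathrm{dR}}$ and an $L$-linear map $M_{\mathrm B}\to N_{\mathrm B}$ that are compatible with $c_M$ and $c_N$. The objects of $\mathscr C_{\mathrm{dRB}}:=\mathscr C_{\mathbb Q}$ are called de Rham–Betti objects, those of $\mathscr C_{\overline{\mathbb Q}\text{-}\mathrm{dRB}}:=\mathscr C_{\overline{\mathbb Q}}$ are called $\overline{\mathbb Q}$-de Rham–Betti objects. Let $\omega_{\mathrm{dR}}\colon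 M\mapsto M_{\mathrm{dR}}$ and $\omega_{\mathrm B}\colon M\mapsto M_{\mathrm B}$ be the two fibre functors. For an object $M$ let $\langle M\rangle$ be the Tannakian subcategory generated by $M$, i.e. the full subcategory of all subquotients of finite direct sums of objects $M^{\otimes n}\otimes (M^\vee)^{\otimes m}$. For tensor functors $F,G$ with values in finite-dimensional vector spaces over a field $E$, let $\operatorname{Iso}^\otimes(F,G)$ be the affine $E$-scheme whose points over a commutative $E$-algebra $R$ are the isomorphisms of tensor functors $F\otimes_E R\to G\otimes_E R$, and let $\operatorname{Aut}^\otimes(F)=\operatorname{Iso}^\otimes(F,F)$. A scheme is called connected if its underlying topological space is connected (in particular non-empty). (1) The de Rham–Betti group $G_{\mathrm{dRB}}=\operatorname{Aut}^\otimes(\omega_{\mathrm B})$, an affine group scheme over $\mathbb Q$, and the torsor of periods $\Omega^{\mathrm{dRB}}=\operatorname{Iso}^\otimes(\omega_{\mathrm{dR}},\omega_{\mathrm B}\otimes_{\mathbb Q}\overline{\mathbb Q})$, an affine scheme over $\overline{\mathbb Q}$, both formed on $\mathscr C_{\mathrm{dRB}}$, are connected. Moreover, for every de Rham–Betti object $M$,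 both $G_{\mathrm{dRB}}(M)=\operatorname{Aut}^\otimes(\omega_{\mathrm B}|_{\langle M\rangle})$ and $\Omega^{\mathrm{dRB}}_M=\operatorname{Iso}^\otimes(\omega_{\mathrm{dR}}|_{\langle M\rangle},\omega_{\mathrm B}|_{\langle M\rangle}\otimes_{\mathbb Q}\overline{\mathbb Q})$ are connected. (2) The $\overline{\mathbb Q}$-de Rham–Betti group $G_{\overline{\mathbb Q}\text{-}\mathrm{dRB}}=\operatorname{Aut}^\otimes(\omega_{\mathrm B})$ and the $\overline{\mathbb Q}$-de Rham–Betti torsor of periods $\Omega^{\overline{\mathbb Q}\text{-}\mathrm{dRB}}=\operatorname{Iso}^\otimes(\omega_{\mathrm{dR}},\omega_{\mathrm B})$, both affine over $\overline{\mathbb Q}$ and formed on $\mathscr C_{\overline{\mathbb Q}\text{-}\mathrm{dRB}}$, are connected. Moreover, for every $\overline{\mathbb Q}$-de Rham–Betti object $M$, both $G_{\overline{\mathbb Q}\text{-}\mathrm{dRB}}(M)=\operatorname{Aut}^\otimes(\omega_{\mathrm B}|_{\langle M\rangle})$ and $\Omega^{\overline{\mathbb Q}\text{-}\mathrm{dRB}}_M=\operatorname{Iso}^\otimes(\omega_{\mathrm{dR}}|_{\langle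 M\rangle},\omega_{\mathrm B}|_{\langle M\rangle})$ are connected. -/

import Mathlib

namespace DeRhamBetti

noncomputable section

open CategoryTheory MonoidalCategory TensorProduct

set_option linter.unusedSectionVars false

/-! ### Base change of tensor products -/

/-- For modules `V`, `W` over `k` and a commutative `k`-algebra `R`, the canonical `R`-bilinear map
`V_R × W_R → (V ⊗ W)_R`, `(r ⊗ v, s ⊗ w) ↦ rs ⊗ (v ⊗ w)`, where `V_R = R ⊗ V`. -/
def bcMul (k R V W : Type*) [CommRing k] [CommRing R] [Algebra k R]
    [AddCommGroup V] [Module k V] [AddCommGroup W] [Module k W] :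
    R ⊗[k] V →ₗ[R] R ⊗[k] W →ₗ[R] R ⊗[k] (V ⊗[k] W) :=
  (TensorProduct.mk R (R ⊗[k] V) (R ⊗[k] W)).compr₂
    (AlgebraTensorModule.distribBaseChange k R V W).symm.toLinearMap

section bcMul

variable {k R V W : Type*} [CommRing k] [CommRing R] [Algebra k R]
  [AddCommGroup V] [Module k V] [AddCommGroup W] [Module k W]

lemma bcMul_tmul (r s : R) (v : V) (w : W) :
    bcMul k R V W (r ⊗ₜ v) (s ⊗ₜ w) = (r * s) ⊗ₜ (v ⊗ₜ w) := by
  simp only [bcMul, LinearMap.compr₂_apply, TensorProduct.mk_apply, LinearEquiv.coe_coe]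
  rw [LinearEquiv.symm_apply_eq]
  simp only [AlgebraTensorModule.distribBaseChange_tmul]
  rw [show (r * s) ⊗ₜ[k] v = s • (r ⊗ₜ[k] v) by simp [smul_tmul', mul_comm],
    TensorProduct.smul_tmul]
  simp [smul_tmul']

end bcMul

lemma bcMul_induction {k R V W : Type*} [CommRing k] [CommRing R] [Algebra k R]
    [AddCommGroup V] [Module k V] [AddCommGroup W] [Module k W]
    {p : R ⊗[k] (V ⊗[k] W) → Prop} (hadd : ∀ x y, p x → p y → p (x + y))
    (h0 : p 0)
    (hmul : ∀ a b, p (bcMul k R V W a b)) (z) : p z := by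
  induction z with
  | zero => exact h0
  | add x y hx hy => exact hadd x y hx hy
  | tmul r t =>
    induction t with
    | zero => simpa using h0
    | add x y hx hy => rw [tmul_add]; exact hadd _ _ hx hy
    | tmul v w => simpa [bcMul_tmul] using hmul (r ⊗ₜ v) (1 ⊗ₜ w)

lemma bcMul_map {k R V W V' W' : Type*} [CommRing k] [CommRing R] [Algebra k R]
    [AddCommGroup V] [Module k V] [AddCommGroup W] [Module k W]
    [AddCommGroup V'] [Module k V'] [AddCommGroup W'] [Module k W']
    (f : V →ₗ[k] V') (g : W →ₗ[k] W') (a : R ⊗[k] V) (b : R ⊗[k] W) :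
    (TensorProduct.map f g).baseChange R (bcMul k R V W a b) =
      bcMul k R V' W' (f.baseChange R a) (g.baseChange R b) := by
  induction a with
  | zero => simp
  | add x y hx hy => simp [hx, hy]
  | tmul r v =>
    induction b with
    | zero => simp
    | add x y hx hy => simp [hx, hy]
    | tmul s w => simp [bcMul_tmul]

lemma bcMul_assoc {k R V W U : Type*} [CommRing k] [CommRing R] [Algebra k R]
    [AddCommGroup V] [Module k V] [AddCommGroup W] [Module k W]
    [AddCommGroup U] [Module k U]
    (a : R ⊗[k] V) (b : R ⊗[k] W) (d : R ⊗[k] U) :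
    (TensorProduct.assoc k V W U).toLinearMap.baseChange R
      (bcMul k R _ U (bcMul k R V W a b) d) =
      bcMul k R V _ a (bcMul k R W U b d) := by
  induction a with
  | zero => simp
  | add x y hx hy => simp [hx, hy]
  | tmul r v =>
    induction b with
    | zero => simp
    | add x y hx hy => simp [hx, hy]
    | tmul s w =>
      induction d with
      | zero => simp
      | add x y hx hy => simp [hx, hy]
      | tmul s w => simp [bcMul_tmul, mul_assoc]

lemma bcMul_lid {k R V : Type*} [CommRing k] [CommRing R] [Algebra k R]
    [AddCommGroup V] [Module k V] (a : R ⊗[k] k) (b : R ⊗[k] V) :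
    (TensorProduct.lid k V).toLinearMap.baseChange R (bcMul k R k V a b) =
      AlgebraTensorModule.rid k R R a • b := by
  induction a with
  | zero => simp
  | add x y hx hy => simp [hx, hy, add_smul]
  | tmul r v =>
    induction b with
    | zero => simp
    | add x y hx hy => simp only [map_add, hx, hy, smul_add]
    | tmul s w => simp [bcMul_tmul, smul_tmul']

lemma bcMul_rid {k R V : Type*} [CommRing k] [CommRing R] [Algebra k R]
    [AddCommGroup V] [Module k V] (a : R ⊗[k] k) (b : R ⊗[k] V) :
    (TensorProduct.rid k V).toLinearMap.baseChange R (bcMul k R V k b a) =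
      AlgebraTensorModule.rid k R R a • b := by
  induction a with
  | zero => simp
  | add x y hx hy => simp [hx, hy, add_smul]
  | tmul r v =>
    induction b with
    | zero => simp
    | add x y hx hy => simp only [map_add, LinearMap.add_apply, hx, hy, smul_add]
    | tmul s w => simp [bcMul_tmul, smul_tmul', mul_comm]

/-- The `L`-de Rham--Betti objects over `K`, for fields `K`, `L` embedded in `ℂ`: triples
`(M_dR, M_B, c_M)` of a finite-dimensional `K`-vector space, a finite-dimensional `L`-vector space
and a `ℂ`-linear isomorphism `c_M : M_dR ⊗_K ℂ ≃ M_B ⊗_L ℂ`. -/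
structure DRB (K L : Type) [Field K] [Field L] [Algebra K ℂ] [Algebra L ℂ] : Type 1 where
  dR : Type
  B : Type
  [acg_dR : AddCommGroup dR]
  [mod_dR : Module K dR]
  [fin_dR : Module.Finite K dR]
  [acg_B : AddCommGroup B]
  [mod_B : Module L B]
  [fin_B : Module.Finite L B]
  c : ℂ ⊗[K] dR ≃ₗ[ℂ] ℂ ⊗[L] B

namespace DRB

attribute [instance] acg_dR mod_dR fin_dR acg_B mod_B fin_B

variable {K L : Type} [Field K] [Field L] [Algebra K ℂ] [Algebra L ℂ]

/-- Homomorphisms of de Rham--Betti objects: pairs of linear maps compatible with the comparison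
isomorphisms. -/
@[ext]
structure Hom (M N : DRB K L) where
  dR : M.dR →ₗ[K] N.dR
  B : M.B →ₗ[L] N.B
  comm : ∀ z, N.c (dR.baseChange ℂ z) = B.baseChange ℂ (M.c z)

instance : Category (DRB K L) where
  Hom := Hom
  id M := ⟨LinearMap.id, LinearMap.id, fun z ↦ by simp⟩
  comp f g := ⟨g.dR ∘ₗ f.dR, g.B ∘ₗ f.B, fun z ↦ by
    simp [LinearMap.baseChange_comp, g.comm, f.comm]⟩

@[ext]
lemma hom_ext {M N : DRB K L} {f g : M ⟶ N} (h : f.dR = g.dR) (h' : f.B = g.B) : f = g :=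
  Hom.ext h h'

@[simp] lemma id_dR (M : DRB K L) : Hom.dR (𝟙 M) = LinearMap.id := rfl
@[simp] lemma id_B (M : DRB K L) : Hom.B (𝟙 M) = LinearMap.id := rfl
@[simp] lemma comp_dR {M N P : DRB K L} (f : M ⟶ N) (g : N ⟶ P) :
    (f ≫ g).dR = g.dR ∘ₗ f.dR := rfl
@[simp] lemma comp_B {M N P : DRB K L} (f : M ⟶ N) (g : N ⟶ P) :
    (f ≫ g).B = g.B ∘ₗ f.B := rfl

/-- The de Rham fibre functor `M ↦ M_dR`. -/
def omegaDR (K L : Type) [Field K] [Field L] [Algebra K ℂ] [Algebra L ℂ] :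
    DRB K L ⥤ ModuleCat.{0} K where
  obj M := ModuleCat.of K M.dR
  map f := ModuleCat.ofHom f.dR

/-- The Betti fibre functor `M ↦ M_B`. -/
def omegaB (K L : Type) [Field K] [Field L] [Algebra K ℂ] [Algebra L ℂ] :
    DRB K L ⥤ ModuleCat.{0} L where
  obj M := ModuleCat.of L M.B
  map f := ModuleCat.ofHom f.B



/-- The comparison isomorphism of a tensor product: `c_M ⊗ c_N`. -/
def tensorC (M N : DRB K L) :
    ℂ ⊗[K] (M.dR ⊗[K] N.dR) ≃ₗ[ℂ] ℂ ⊗[L] (M.B ⊗[L] N.B) :=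
  AlgebraTensorModule.distribBaseChange K ℂ M.dR N.dR ≪≫ₗ
    TensorProduct.congr M.c N.c ≪≫ₗ
    (AlgebraTensorModule.distribBaseChange L ℂ M.B N.B).symm

lemma tensorC_bcMul (M N : DRB K L) (a : ℂ ⊗[K] M.dR) (b : ℂ ⊗[K] N.dR) :
    tensorC M N (bcMul K ℂ M.dR N.dR a b) = bcMul L ℂ M.B N.B (M.c a) (N.c b) := by
  simp [tensorC, bcMul]

/-- The comparison isomorphism of the unit object, i.e. the identity of `ℂ`. -/
def unitC (K L : Type) [Field K] [Field L] [Algebra K ℂ] [Algebra L ℂ] :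
    ℂ ⊗[K] K ≃ₗ[ℂ] ℂ ⊗[L] L :=
  AlgebraTensorModule.rid K ℂ ℂ ≪≫ₗ (AlgebraTensorModule.rid L ℂ ℂ).symm

lemma unitC_tmul (z : ℂ) (a : K) : unitC K L (z ⊗ₜ a) = (a • z) ⊗ₜ 1 := by
  simp [unitC]

/-- The tensor product `(M_dR ⊗ N_dR, M_B ⊗ N_B, c_M ⊗ c_N)`. -/
abbrev tensor (M N : DRB K L) : DRB K L := ⟨M.dR ⊗[K] N.dR, M.B ⊗[L] N.B, tensorC M N⟩

variable (K L) in
/-- The unit object `(K, L, id)`. -/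
abbrev one : DRB K L := ⟨K, L, unitC K L⟩

/-- The tensor product of two homomorphisms. -/
def tensorMap {M N M' N' : DRB K L} (f : Hom M N) (g : Hom M' N') :
    Hom (tensor M M') (tensor N N') where
  dR := TensorProduct.map f.dR g.dR
  B := TensorProduct.map f.B g.B
  comm z := by
    dsimp only
    induction z using bcMul_induction with
    | hadd x y hx hy => simp only [map_add, hx, hy]
    | h0 => simp
    | hmul a b => simp only [bcMul_map, tensorC_bcMul, f.comm, g.comm]

lemma assoc_comm (M N P : DRB K L) (z : ℂ ⊗[K] ((M.dR ⊗[K] N.dR) ⊗[K] P.dR)) :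
    tensorC M (tensor N P)
        ((TensorProduct.assoc K M.dR N.dR P.dR).toLinearMap.baseChange ℂ z) =
      (TensorProduct.assoc L M.B N.B P.B).toLinearMap.baseChange ℂ
        (tensorC (tensor M N) P z) := by
  induction z using bcMul_induction with
  | hadd x y hx hy => simp only [map_add, hx, hy]
  | h0 => simp only [map_zero]
  | hmul a b =>
    induction a using bcMul_induction with
    | hadd x y hx hy => simp only [map_add, LinearMap.add_apply, hx, hy]
    | h0 => simp only [map_zero, LinearMap.zero_apply]
    | hmul a d =>
      have h1 := tensorC_bcMul M (tensor N P) a (bcMul K ℂ N.dR P.dR d b)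
      have h2 := tensorC_bcMul (tensor M N) P (bcMul K ℂ M.dR N.dR a d) b
      rw [bcMul_assoc]
      refine h1.trans ?_
      refine Eq.trans ?_ (congrArg _ h2).symm
      dsimp only
      rw [tensorC_bcMul, tensorC_bcMul, bcMul_assoc]

lemma lid_comm (M : DRB K L) (z : ℂ ⊗[K] (K ⊗[K] M.dR)) :
    M.c ((TensorProduct.lid K M.dR).toLinearMap.baseChange ℂ z) =
      (TensorProduct.lid L M.B).toLinearMap.baseChange ℂ (tensorC (one K L) M z) := by
  induction z using bcMul_induction with
  | hadd x y hx hy => simp only [map_add, hx, hy]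
  | h0 => simp only [map_zero]
  | hmul a b =>
    rw [bcMul_lid]
    refine Eq.trans ?_ (congrArg _ (tensorC_bcMul (one K L) M a b)).symm
    rw [bcMul_lid]
    simp [unitC]

lemma rid_comm (M : DRB K L) (z : ℂ ⊗[K] (M.dR ⊗[K] K)) :
    M.c ((TensorProduct.rid K M.dR).toLinearMap.baseChange ℂ z) =
      (TensorProduct.rid L M.B).toLinearMap.baseChange ℂ (tensorC M (one K L) z) := by
  induction z using bcMul_induction with
  | hadd x y hx hy => simp only [map_add, hx, hy]
  | h0 => simp only [map_zero]
  | hmul a b =>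
    rw [bcMul_rid]
    refine Eq.trans ?_ (congrArg _ (tensorC_bcMul M (one K L) a b)).symm
    rw [bcMul_rid]
    simp [unitC]

/-- Isomorphisms from pairs of compatible linear isomorphisms. -/
def isoMk {M N : DRB K L} (e : M.dR ≃ₗ[K] N.dR) (e' : M.B ≃ₗ[L] N.B)
    (h : ∀ z, N.c (e.toLinearMap.baseChange ℂ z) = e'.toLinearMap.baseChange ℂ (M.c z)) :
    M ≅ N where
  hom := ⟨e.toLinearMap, e'.toLinearMap, h⟩
  inv := ⟨e.symm.toLinearMap, e'.symm.toLinearMap, fun z ↦ by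
    obtain ⟨z, rfl⟩ := (e.baseChange K ℂ _ _).surjective z
    have h1 := h z
    have h2 : e.symm.toLinearMap.baseChange ℂ (e.toLinearMap.baseChange ℂ z) = z := by
      rw [← LinearMap.comp_apply, ← LinearMap.baseChange_comp]; simp
    have h3 (w) : e'.symm.toLinearMap.baseChange ℂ (e'.toLinearMap.baseChange ℂ w) = w := by
      rw [← LinearMap.comp_apply, ← LinearMap.baseChange_comp]; simp
    change M.c (e.symm.toLinearMap.baseChange ℂ (e.toLinearMap.baseChange ℂ z)) =
      e'.symm.toLinearMap.baseChange ℂ (N.c (e.toLinearMap.baseChange ℂ z))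
    rw [h2, h1, h3]⟩
  hom_inv_id := by ext <;> simp
  inv_hom_id := by ext <;> simp

instance : MonoidalCategoryStruct (DRB K L) where
  tensorObj M N := tensor M N
  tensorUnit := one K L
  tensorHom f g := tensorMap f g
  whiskerLeft M _ _ f := tensorMap (𝟙 M) f
  whiskerRight f M := tensorMap f (𝟙 M)
  associator M N P := isoMk (TensorProduct.assoc K M.dR N.dR P.dR)
    (TensorProduct.assoc L M.B N.B P.B) (assoc_comm M N P)
  leftUnitor M := isoMk (TensorProduct.lid K M.dR) (TensorProduct.lid L M.B) (lid_comm M)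
  rightUnitor M := isoMk (TensorProduct.rid K M.dR) (TensorProduct.rid L M.B) (rid_comm M)

instance : MonoidalCategory (DRB K L) := MonoidalCategory.ofTensorHom
  (id_tensorHom_id := fun _ _ ↦ hom_ext TensorProduct.map_id TensorProduct.map_id)
  (tensorHom_comp_tensorHom := fun _ _ _ _ ↦
    hom_ext (TensorProduct.map_comp _ _ _ _).symm (TensorProduct.map_comp _ _ _ _).symm)
  (associator_naturality := fun _ _ _ ↦
    hom_ext (TensorProduct.ext_threefold fun _ _ _ ↦ rfl)
      (TensorProduct.ext_threefold fun _ _ _ ↦ rfl))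
  (leftUnitor_naturality := fun f ↦
    hom_ext (TensorProduct.ext' fun a m ↦ (f.dR.map_smul a m).symm)
      (TensorProduct.ext' fun a m ↦ (f.B.map_smul a m).symm))
  (rightUnitor_naturality := fun f ↦
    hom_ext (TensorProduct.ext' fun m a ↦ (f.dR.map_smul a m).symm)
      (TensorProduct.ext' fun m a ↦ (f.B.map_smul a m).symm))
  (pentagon := fun _ _ _ _ ↦
    hom_ext (TensorProduct.ext_fourfold fun _ _ _ _ ↦ rfl)
      (TensorProduct.ext_fourfold fun _ _ _ _ ↦ rfl))
  (triangle := fun _ _ ↦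
    hom_ext (TensorProduct.ext_threefold fun m a n ↦
      (TensorProduct.smul_tmul a m n).symm)
      (TensorProduct.ext_threefold fun m a n ↦ (TensorProduct.smul_tmul a m n).symm))

instance : (omegaDR K L).Monoidal :=
  Functor.CoreMonoidal.toMonoidal
    { εIso := Iso.refl _
      μIso _ _ := Iso.refl _
      μIso_hom_natural_left _ _ := rfl
      μIso_hom_natural_right _ _ := rfl
      associativity _ _ _ := ModuleCat.MonoidalCategory.tensor_ext₃' fun _ _ _ ↦ rfl
      left_unitality _ := ModuleCat.MonoidalCategory.tensor_ext fun _ _ ↦ rfl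
      right_unitality _ := ModuleCat.MonoidalCategory.tensor_ext fun _ _ ↦ rfl }

instance : (omegaB K L).Monoidal :=
  Functor.CoreMonoidal.toMonoidal
    { εIso := Iso.refl _
      μIso _ _ := Iso.refl _
      μIso_hom_natural_left _ _ := rfl
      μIso_hom_natural_right _ _ := rfl
      associativity _ _ _ := ModuleCat.MonoidalCategory.tensor_ext₃' fun _ _ _ ↦ rfl
      left_unitality _ := ModuleCat.MonoidalCategory.tensor_ext fun _ _ ↦ rfl
      right_unitality _ := ModuleCat.MonoidalCategory.tensor_ext fun _ _ ↦ rfl }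


/-- The comparison isomorphism of the dual: the contragredient of `c_M`. -/
def dualC (M : DRB K L) : ℂ ⊗[K] Module.Dual K M.dR ≃ₗ[ℂ] ℂ ⊗[L] Module.Dual L M.B :=
  (TensorProduct.isBaseChange K M.dR ℂ).toDualBaseChange ≪≫ₗ M.c.symm.dualMap ≪≫ₗ
    (TensorProduct.isBaseChange L M.B ℂ).toDualBaseChange.symm

lemma dualC_pairing (M : DRB K L) (φ : ℂ ⊗[K] Module.Dual K M.dR) (v : ℂ ⊗[K] M.dR) :
    (TensorProduct.isBaseChange L M.B ℂ).toDualBaseChange (dualC M φ) (M.c v) =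
      (TensorProduct.isBaseChange K M.dR ℂ).toDualBaseChange φ v := by
  simp [dualC]

/-- The dual object. -/
abbrev dual (M : DRB K L) : DRB K L := ⟨Module.Dual K M.dR, Module.Dual L M.B, dualC M⟩

/-- The comparison isomorphism of a direct sum: `c_M ⊕ c_N`. -/
def directSumC (M N : DRB K L) :
    ℂ ⊗[K] (M.dR × N.dR) ≃ₗ[ℂ] ℂ ⊗[L] (M.B × N.B) :=
  TensorProduct.prodRight K ℂ ℂ M.dR N.dR ≪≫ₗ M.c.prodCongr N.c ≪≫ₗ
    (TensorProduct.prodRight L ℂ ℂ M.B N.B).symm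

/-- The direct sum of two objects. -/
abbrev directSum (M N : DRB K L) : DRB K L := ⟨M.dR × N.dR, M.B × N.B, directSumC M N⟩

/-- `M` is a subquotient of `N`: a quotient of a subobject of `N`. -/
def IsSubquotient (M N : DRB K L) : Prop :=
  ∃ (P : DRB K L) (i : P ⟶ N) (q : P ⟶ M), Mono i ∧ Epi q

/-- The objects of `⟨M⟩`, the Tannakian subcategory generated by `M`: the smallest class of objects
containing `M` and the unit and stable under tensor products, duals, finite direct sums and
subquotients (equivalently: the subquotients of finite direct sums of `M^{⊗ n} ⊗ (M^∨)^{⊗ m}`). -/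
inductive generated (M : DRB K L) : ObjectProperty (DRB K L)
  | self : generated M M
  | one : generated M (𝟙_ (DRB K L))
  | tensor {X Y} : generated M X → generated M Y → generated M (X ⊗ Y)
  | dual {X} : generated M X → generated M (dual X)
  | directSum {X Y} : generated M X → generated M Y → generated M (directSum X Y)
  | subquotient {X Y} : IsSubquotient X Y → generated M Y → generated M X

instance (M : DRB K L) : (generated M).IsMonoidal where
  prop_unit := generated.one
  prop_tensor _ _ := generated.tensor

end DRB

section TensorIso
universe u v w
variable {E : Type} [Field E] {C : Type u} [Category.{v} C] [MonoidalCategory C]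

open Functor.LaxMonoidal

/-- The `R`-bilinear extension `F(X)_R × F(Y)_R → F(X ⊗ Y)_R` of the tensor structure of `F`. -/
def tensorMul (F : C ⥤ ModuleCat.{0} E) [F.LaxMonoidal] (R : Type w) [CommRing R] [Algebra E R]
    (X Y : C) : R ⊗[E] F.obj X →ₗ[R] R ⊗[E] F.obj Y →ₗ[R] R ⊗[E] F.obj (X ⊗ Y) :=
  (bcMul E R (F.obj X) (F.obj Y)).compr₂ ((μ F X Y).hom.baseChange R)

/-- The points of `Iso^⊗(F, G)` over a commutative `E`-algebra `R`: isomorphisms of tensor functors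
from `F_R : X ↦ F(X) ⊗_E R` to `G_R : X ↦ G(X) ⊗_E R`. -/
@[ext]
structure TensorIso (F G : C ⥤ ModuleCat.{0} E) [F.LaxMonoidal] [G.LaxMonoidal]
    (R : Type w) [CommRing R] [Algebra E R] where
  app (X : C) : R ⊗[E] F.obj X ≃ₗ[R] R ⊗[E] G.obj X
  naturality {X Y : C} (f : X ⟶ Y) (a : R ⊗[E] F.obj X) :
    app Y ((F.map f).hom.baseChange R a) = (G.map f).hom.baseChange R (app X a)
  unit : app (𝟙_ C) (1 ⊗ₜ (ε F).hom (1 : E)) = 1 ⊗ₜ (ε G).hom (1 : E)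
  tensor (X Y : C) (a : R ⊗[E] F.obj X) (b : R ⊗[E] F.obj Y) :
    app (X ⊗ Y) (tensorMul F R X Y a b) = tensorMul G R X Y (app X a) (app Y b)



/-- For a homomorphism `φ : R → S` of `E`-algebras, the induced map `V_R → V_S`. -/
abbrev bc {R S : Type*} [CommRing R] [CommRing S] [Algebra E R] [Algebra E S] (φ : R →ₐ[E] S)
    (V : Type*) [AddCommGroup V] [Module E V] : R ⊗[E] V →ₗ[E] S ⊗[E] V :=
  φ.toLinearMap.rTensor V

namespace TensorIso

variable (F G : C ⥤ ModuleCat.{0} E) [∀ X, Module.Finite E (F.obj X)]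
  [∀ X, Module.Finite E (G.obj X)]

/-- Index set for the entries of the matrices of a family of isomorphisms `F(X) → G(X)` and of
their inverses. -/
abbrev Coord : Type u :=
  Σ X : C, (Fin (Module.finrank E (G.obj X)) × Fin (Module.finrank E (F.obj X))) ⊕
    (Fin (Module.finrank E (F.obj X)) × Fin (Module.finrank E (G.obj X)))

variable (E) in
/-- A basis of `V_R` coming from `V`. -/
abbrev bas (R : Type*) [CommRing R] [Algebra E R] (V : Type*) [AddCommGroup V] [Module E V]
    [Module.Finite E V] : Module.Basis (Fin (Module.finrank E V)) R (R ⊗[E] V) :=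
  (Module.finBasis E V).baseChange R

section
variable {R S : Type*} [CommRing R] [Algebra E R] [CommRing S] [Algebra E S]
  {V W : Type*} [AddCommGroup V] [Module E V] [AddCommGroup W] [Module E W]

lemma bc_smul (φ : R →ₐ[E] S) (r : R) (a : R ⊗[E] V) : bc φ V (r • a) = φ r • bc φ V a := by
  induction a with
  | zero => simp
  | add x y hx hy => simp only [smul_add, map_add, hx, hy]
  | tmul s v => simp [smul_tmul']

lemma bc_baseChange (φ : R →ₐ[E] S) (f : V →ₗ[E] W) (a : R ⊗[E] V) :
    bc φ W (f.baseChange R a) = f.baseChange S (bc φ V a) := by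
  induction a with
  | zero => simp
  | add x y hx hy => simp only [map_add, hx, hy]
  | tmul s v => simp

lemma bc_bcMul (φ : R →ₐ[E] S) (a : R ⊗[E] V) (b : R ⊗[E] W) :
    bc φ _ (bcMul E R V W a b) = bcMul E S V W (bc φ V a) (bc φ W b) := by
  induction a with
  | zero => simp
  | add x y hx hy => simp only [map_add, LinearMap.add_apply, hx, hy]
  | tmul s v =>
    induction b with
    | zero => simp
    | add x y hx hy => simp only [map_add, hx, hy]
    | tmul t w => simp [bcMul_tmul]

lemma ext_bc (φ : R →ₐ[E] S) {f g : S ⊗[E] V →ₗ[S] S ⊗[E] W}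
    (h : ∀ a, f (bc φ V a) = g (bc φ V a)) : f = g := by
  ext v
  simpa using h (1 ⊗ₜ v)

variable [Module.Finite E V] [Module.Finite E W]

lemma bas_repr_bc (φ : R →ₐ[E] S) (a : R ⊗[E] V) (i) :
    (bas E S V).repr (bc φ V a) i = φ ((bas E R V).repr a i) := by
  induction a with
  | zero => simp
  | add x y hx hy => simp only [map_add, Finsupp.add_apply, hx, hy]
  | tmul s v => simp [Module.Basis.baseChange_repr_tmul, Algebra.smul_def, mul_comm]

lemma bc_inj {ι : Sort*} {S : ι → Type*} [∀ i, CommRing (S i)] [∀ i, Algebra E (S i)]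
    (φ : ∀ i, R →ₐ[E] S i) (hφ : ∀ r, (∀ i, φ i r = 0) → r = 0) {a b : R ⊗[E] V}
    (h : ∀ i, bc (φ i) V a = bc (φ i) V b) : a = b := by
  apply (bas E R V).repr.injective
  ext k
  rw [← sub_eq_zero]
  apply hφ
  intro i
  rw [map_sub, ← bas_repr_bc, ← bas_repr_bc, h, sub_self]

variable (V W) in
/-- The linear map `V_R → W_R` with prescribed matrix. -/
def lin (m : Matrix (Fin (Module.finrank E W)) (Fin (Module.finrank E V)) R) :
    R ⊗[E] V →ₗ[R] R ⊗[E] W :=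
  Matrix.toLin (bas E R V) (bas E R W) m

lemma bc_lin (φ : R →ₐ[E] S) (m : Matrix (Fin (Module.finrank E W)) (Fin (Module.finrank E V)) R)
    (a : R ⊗[E] V) : bc φ W (lin V W m a) = lin V W (m.map φ) (bc φ V a) := by
  apply (bas E S W).repr.injective
  ext i
  rw [bas_repr_bc]
  simp only [lin, Matrix.repr_toLin, Matrix.mulVec, dotProduct, map_sum, map_mul, bas_repr_bc,
    Matrix.map_apply]
end

variable {F G}
section
variable {R : Type*} [CommRing R] [Algebra E R] {S : Type*} [CommRing S] [Algebra E S]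

/-- The linear maps `F(X)_R → G(X)_R` with matrix entries `x`. -/
abbrev mU (x : Coord F G → R) (X : C) : R ⊗[E] F.obj X →ₗ[R] R ⊗[E] G.obj X :=
  lin (F.obj X) (G.obj X) (Matrix.of fun i j ↦ x ⟨X, .inl (i, j)⟩)

/-- The linear maps `G(X)_R → F(X)_R` with matrix entries `x`. -/
abbrev mV (x : Coord F G → R) (X : C) : R ⊗[E] G.obj X →ₗ[R] R ⊗[E] F.obj X :=
  lin (G.obj X) (F.obj X) (Matrix.of fun i j ↦ x ⟨X, .inr (i, j)⟩)

lemma bc_mU (φ : R →ₐ[E] S) (x : Coord F G → R) (X : C) (a) :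
    bc φ _ (mU x X a) = mU (fun s ↦ φ (x s)) X (bc φ _ a) := bc_lin φ _ a

lemma bc_mV (φ : R →ₐ[E] S) (x : Coord F G → R) (X : C) (a) :
    bc φ _ (mV x X a) = mV (fun s ↦ φ (x s)) X (bc φ _ a) := bc_lin φ _ a

variable [F.LaxMonoidal] [G.LaxMonoidal]

lemma bc_tensorMul (φ : R →ₐ[E] S) (X Y : C) (a : R ⊗[E] F.obj X) (b : R ⊗[E] F.obj Y) :
    bc φ _ (tensorMul F R X Y a b) = tensorMul F S X Y (bc φ _ a) (bc φ _ b) :=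
  (bc_baseChange φ (μ F X Y).hom _).trans (congrArg _ (bc_bcMul φ a b))

/-- The entries `x` define a tensor isomorphism over `R` and its inverse. -/
structure Good (x : Coord F G → R) : Prop where
  inv₁ (X : C) (a : R ⊗[E] F.obj X) : mV x X (mU x X a) = a
  inv₂ (X : C) (a : R ⊗[E] G.obj X) : mU x X (mV x X a) = a
  naturality {X Y : C} (f : X ⟶ Y) (a : R ⊗[E] F.obj X) :
    mU x Y ((F.map f).hom.baseChange R a) = (G.map f).hom.baseChange R (mU x X a)
  unit : mU x (𝟙_ C) (1 ⊗ₜ (ε F).hom (1 : E)) = 1 ⊗ₜ (ε G).hom (1 : E)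
  tensor (X Y : C) (a : R ⊗[E] F.obj X) (b : R ⊗[E] F.obj Y) :
    mU x (X ⊗ Y) (tensorMul F R X Y a b) = tensorMul G R X Y (mU x X a) (mU x Y b)

lemma Good.of_inj {x : Coord F G → R} {ι : Sort*} {S : ι → Type*} [∀ i, CommRing (S i)]
    [∀ i, Algebra E (S i)]
    (φ : ∀ i, R →ₐ[E] S i) (hφ : ∀ r, (∀ i, φ i r = 0) → r = 0)
    (h : ∀ i, Good fun s ↦ φ i (x s)) : Good x where
  inv₁ X a := bc_inj φ hφ fun i ↦ by rw [bc_mV, bc_mU, (h i).inv₁]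
  inv₂ X a := bc_inj φ hφ fun i ↦ by rw [bc_mU, bc_mV, (h i).inv₂]
  naturality f a := bc_inj φ hφ fun i ↦ by
    rw [bc_mU, bc_baseChange, (h i).naturality, bc_baseChange, bc_mU]
  unit := bc_inj φ hφ fun i ↦ by
    have := (h i).unit
    rw [bc_mU]
    simpa using this
  tensor X Y a b := bc_inj φ hφ fun i ↦ by
    rw [bc_mU, bc_tensorMul, (h i).tensor, bc_tensorMul, bc_mU, bc_mU]

/-- The matrix entries of a tensor isomorphism and of its inverse. -/
def coord (g : TensorIso F G R) : Coord F G → R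
  | ⟨X, .inl (i, j)⟩ => LinearMap.toMatrix (bas E R (F.obj X)) (bas E R (G.obj X)) (g.app X) i j
  | ⟨X, .inr (i, j)⟩ =>
    LinearMap.toMatrix (bas E R (G.obj X)) (bas E R (F.obj X)) (g.app X).symm i j

@[simp] lemma mU_coord (g : TensorIso F G R) (X : C) : mU (coord g) X = g.app X :=
  Matrix.toLin_toMatrix _ _ _

@[simp] lemma mV_coord (g : TensorIso F G R) (X : C) : mV (coord g) X = (g.app X).symm :=
  Matrix.toLin_toMatrix _ _ _

lemma good_coord (g : TensorIso F G R) : Good (coord g) where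
  inv₁ X a := by simp
  inv₂ X a := by simp
  naturality f a := by simpa using g.naturality f a
  unit := by simpa using g.unit
  tensor X Y a b := by simpa using g.tensor X Y a b

/-- The tensor isomorphism with given matrix entries. -/
def ofGood {x : Coord F G → R} (h : Good x) : TensorIso F G R where
  app X := LinearEquiv.ofLinearMap (mU x X) (mV x X) (LinearMap.ext (h.inv₂ X))
    (LinearMap.ext (h.inv₁ X))
  naturality := h.naturality
  unit := h.unit
  tensor := h.tensor

end

variable (F G) [F.LaxMonoidal] [G.LaxMonoidal]

/-- The ideal of relations satisfied by the matrix entries of all tensor isomorphisms: the smallest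
ideal modulo which the tautological matrix entries define a tensor isomorphism. -/
def relations : Ideal (MvPolynomial (Coord F G) E) :=
  sInf {J | Good fun s ↦ Ideal.Quotient.mkₐ E J (MvPolynomial.X s)}

/-- The coordinate ring of the affine `E`-scheme `Iso^⊗(F, G)`; see `existsUnique_map_generic`. -/
abbrev CoordRing : Type u := MvPolynomial (Coord F G) E ⧸ relations F G

lemma good_generic : Good fun s ↦ Ideal.Quotient.mkₐ E (relations F G) (MvPolynomial.X s) := by
  apply Good.of_inj
    (ι := {J : Ideal (MvPolynomial (Coord F G) E) //
      Good fun s ↦ Ideal.Quotient.mkₐ E J (MvPolynomial.X s)})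
    (S := fun J ↦ MvPolynomial (Coord F G) E ⧸ J.1)
    (fun J ↦ Ideal.Quotient.factorₐ E (sInf_le J.2))
  · intro r hr
    obtain ⟨p, rfl⟩ := Ideal.Quotient.mk_surjective r
    rw [Ideal.Quotient.eq_zero_iff_mem]
    refine (Submodule.mem_sInf).2 fun J hJ ↦ ?_
    exact Ideal.Quotient.eq_zero_iff_mem.1 (hr ⟨J, hJ⟩)
  · intro J
    exact J.2

/-- The coordinate functions. -/
def coordFn (s : Coord F G) : CoordRing F G :=
  Ideal.Quotient.mkₐ E (relations F G) (MvPolynomial.X s)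

lemma good_coordFn : Good (coordFn F G) := good_generic F G

/-- The universal tensor isomorphism. -/
def generic : TensorIso F G (CoordRing F G) := ofGood (good_coordFn F G)

lemma generic_app (X : C) (a) : (generic F G).app X a = mU (coordFn F G) X a := rfl

variable {F G}
variable {R : Type w} [CommRing R] [Algebra E R]

lemma bc_generic_app (φ : CoordRing F G →ₐ[E] R) (X : C) (a) :
    bc φ _ ((generic F G).app X a) = mU (fun s ↦ φ (coordFn F G s)) X (bc φ _ a) :=
  bc_mU φ (coordFn F G) X a

lemma exists_algHom (g : TensorIso F G R) :
    ∃ φ : CoordRing F G →ₐ[E] R, ∀ s, φ (coordFn F G s) = coord g s := by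
  let ψ : MvPolynomial (Coord F G) E →ₐ[E] R := MvPolynomial.aeval (coord g)
  have hJ : Good fun s ↦ Ideal.Quotient.mkₐ E (RingHom.ker ψ) (MvPolynomial.X s) := by
    apply Good.of_inj (ι := Unit) (S := fun _ ↦ R) (fun _ ↦ Ideal.kerLiftAlg ψ)
    · intro r hr
      exact (injective_iff_map_eq_zero _).1 (Ideal.kerLiftAlg_injective ψ) r (hr ())
    · intro _
      have : (fun s ↦ Ideal.kerLiftAlg ψ
          (Ideal.Quotient.mkₐ E (RingHom.ker ψ) (MvPolynomial.X s))) = coord g := by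
        funext s
        exact (Ideal.kerLiftAlg_mk ψ _).trans (MvPolynomial.aeval_X _ _)
      rw [this]
      exact good_coord g
  have hle : relations F G ≤ RingHom.ker ψ := sInf_le hJ
  exact ⟨Ideal.Quotient.liftₐ (relations F G) ψ fun a ha ↦ hle ha,
    fun s ↦ MvPolynomial.aeval_X _ _⟩

lemma algHom_ext {φ φ' : CoordRing F G →ₐ[E] R} (h : ∀ s, φ (coordFn F G s) = φ' (coordFn F G s)) :
    φ = φ' :=
  Ideal.Quotient.algHom_ext _ (MvPolynomial.algHom_ext h)

lemma lin_injective {V W : Type*} [AddCommGroup V] [Module E V] [AddCommGroup W] [Module E W]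
    [Module.Finite E V] [Module.Finite E W] : Function.Injective (lin (E := E) (R := R) V W) :=
  (Matrix.toLin (bas E R V) (bas E R W)).injective

lemma eq_coord {g : TensorIso F G R} {φ : CoordRing F G →ₐ[E] R}
    (hφ : ∀ X a, g.app X (bc φ _ a) = bc φ _ ((generic F G).app X a)) (s) :
    φ (coordFn F G s) = coord g s := by
  have h1 (X : C) : mU (fun s ↦ φ (coordFn F G s)) X = mU (coord g) X := by
    refine ext_bc φ fun a ↦ ?_
    rw [← bc_generic_app, ← hφ, mU_coord]
    rfl
  have h2 (X : C) : mV (fun s ↦ φ (coordFn F G s)) X = mV (coord g) X := by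
    refine ext_bc φ fun a ↦ (g.app X).injective ?_
    have h3 : bc φ _ (mV (coordFn F G) X a) = mV (fun s ↦ φ (coordFn F G s)) X (bc φ _ a) :=
      bc_mV φ (coordFn F G) X a
    have h4 : (generic F G).app X (mV (coordFn F G) X a) = a :=
      (generic_app F G X _).trans ((good_coordFn F G).inv₂ X a)
    rw [← h3, hφ, h4, mV_coord]
    exact ((g.app X).apply_symm_apply _).symm
  obtain ⟨X, ⟨i, j⟩ | ⟨i, j⟩⟩ := s
  · exact congrFun (congrFun (lin_injective (h1 X)) i) j
  · exact congrFun (congrFun (lin_injective (h2 X)) i) j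

/-- The affine scheme `Spec (CoordRing F G)` represents the functor of tensor isomorphisms:
`E`-algebra homomorphisms `CoordRing F G → R` correspond to tensor isomorphisms over `R`. -/
theorem existsUnique_map_generic (g : TensorIso F G R) :
    ∃! φ : CoordRing F G →ₐ[E] R, ∀ (X : C) (a : CoordRing F G ⊗[E] F.obj X),
      g.app X (bc φ _ a) = bc φ _ ((generic F G).app X a) := by
  obtain ⟨φ, h⟩ := exists_algHom g
  refine ⟨φ, fun X a ↦ ?_, fun φ' h' ↦ algHom_ext fun s ↦ by rw [h, eq_coord h']⟩
  rw [bc_generic_app, funext h, mU_coord]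
  rfl

variable (F G)

/-- The affine scheme `Iso^⊗(F, G)`, the spectrum of the `E`-algebra representing the functor
`R ↦ TensorIso F G R`. -/
def scheme : AlgebraicGeometry.Scheme.{u} := AlgebraicGeometry.Spec (.of (CoordRing F G))

end TensorIso

/-- The points of `Aut^⊗(F) = Iso^⊗(F, F)` form a group under composition. -/
instance (F : C ⥤ ModuleCat.{0} E) [F.LaxMonoidal] (R : Type w) [CommRing R] [Algebra E R] :
    Group (TensorIso F F R) where
  one := ⟨fun X ↦ LinearEquiv.refl R _, fun _ _ ↦ rfl, rfl, fun _ _ _ _ ↦ rfl⟩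
  mul g h := ⟨fun X ↦ (h.app X).trans (g.app X),
    fun f a ↦ by simp [h.naturality, g.naturality], by simp [h.unit, g.unit],
    fun X Y a b ↦ by simp [h.tensor, g.tensor]⟩
  inv g := ⟨fun X ↦ (g.app X).symm,
    fun {X Y} f a ↦ by
      rw [LinearEquiv.symm_apply_eq, g.naturality, LinearEquiv.apply_symm_apply],
    by rw [LinearEquiv.symm_apply_eq, g.unit],
    fun X Y a b ↦ by
      rw [LinearEquiv.symm_apply_eq, g.tensor, LinearEquiv.apply_symm_apply,
        LinearEquiv.apply_symm_apply]⟩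
  mul_assoc _ _ _ := rfl
  one_mul _ := rfl
  mul_one _ := rfl
  inv_mul_cancel g := TensorIso.ext (funext fun X ↦ LinearEquiv.ext fun a ↦
    (g.app X).symm_apply_apply a)

end TensorIso

/-! ### The de Rham--Betti groups and the torsors of periods -/

section Finite

variable {K L : Type} [Field K] [Field L] [Algebra K ℂ] [Algebra L ℂ]

instance (M : DRB K L) : Module.Finite K ((DRB.omegaDR K L).obj M) :=
  inferInstanceAs (Module.Finite K M.dR)

instance (M : DRB K L) : Module.Finite L ((DRB.omegaB K L).obj M) :=
  inferInstanceAs (Module.Finite L M.B)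

instance {E : Type} [Field E] [Algebra L E] (M : DRB K L) :
    Module.Finite E
      ((DRB.omegaB K L ⋙ ModuleCat.extendScalars.{0, 0, 0} (algebraMap L E)).obj M) :=
  letI := (algebraMap L E).toAlgebra
  inferInstanceAs (Module.Finite E (E ⊗[L] M.B))

instance {E : Type} [Field E] {C : Type*} [Category* C] (P : ObjectProperty C)
    (F : C ⥤ ModuleCat.{0} E) [h : ∀ X, Module.Finite E (F.obj X)] (X : P.FullSubcategory) :
    Module.Finite E ((P.ι ⋙ F).obj X) :=
  h X.obj

end Finite

/-- The algebraic closure `ℚ̄` of `ℚ` inside `ℂ`. -/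
abbrev Qbar : IntermediateField ℚ ℂ := algebraicClosure ℚ ℂ

/-- The category of de Rham--Betti objects. -/
abbrev DRBObj : Type 1 := DRB Qbar ℚ

/-- The category of `ℚ̄`-de Rham--Betti objects. -/
abbrev QbarDRBObj : Type 1 := DRB Qbar Qbar

/-- The tensor functor `ω_B ⊗ ℚ̄` on de Rham--Betti objects. -/
abbrev omegaBQbar : DRBObj ⥤ ModuleCat.{0} Qbar :=
  DRB.omegaB Qbar ℚ ⋙ ModuleCat.extendScalars (algebraMap ℚ Qbar)

/-- The de Rham--Betti group `G_dRB = Aut^⊗(ω_B)`, an affine group scheme over `ℚ`. -/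
def GdRB : AlgebraicGeometry.Scheme.{1} :=
  TensorIso.scheme (DRB.omegaB Qbar ℚ) (DRB.omegaB Qbar ℚ)

/-- The torsor of periods `Ω^dRB = Iso^⊗(ω_dR, ω_B ⊗ ℚ̄)`, an affine scheme over `ℚ̄`. -/
def OmegadRB : AlgebraicGeometry.Scheme.{1} :=
  TensorIso.scheme (DRB.omegaDR Qbar ℚ) omegaBQbar

/-- `G_dRB(M) = Aut^⊗(ω_B|⟨M⟩)`. -/
def GdRBOf (M : DRBObj) : AlgebraicGeometry.Scheme.{1} :=
  TensorIso.scheme ((DRB.generated M).ι ⋙ DRB.omegaB Qbar ℚ)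
    ((DRB.generated M).ι ⋙ DRB.omegaB Qbar ℚ)

/-- `Ω^dRB_M = Iso^⊗(ω_dR|⟨M⟩, ω_B|⟨M⟩ ⊗ ℚ̄)`. -/
def OmegadRBOf (M : DRBObj) : AlgebraicGeometry.Scheme.{1} :=
  TensorIso.scheme ((DRB.generated M).ι ⋙ DRB.omegaDR Qbar ℚ) ((DRB.generated M).ι ⋙ omegaBQbar)

/-- The `ℚ̄`-de Rham--Betti group `Aut^⊗(ω_B)`, an affine group scheme over `ℚ̄`. -/
def GQbardRB : AlgebraicGeometry.Scheme.{1} :=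
  TensorIso.scheme (DRB.omegaB Qbar Qbar) (DRB.omegaB Qbar Qbar)

/-- The `ℚ̄`-de Rham--Betti torsor of periods `Iso^⊗(ω_dR, ω_B)`. -/
def OmegaQbardRB : AlgebraicGeometry.Scheme.{1} :=
  TensorIso.scheme (DRB.omegaDR Qbar Qbar) (DRB.omegaB Qbar Qbar)

/-- The group `Aut^⊗(ω_B|⟨M⟩)` of a `ℚ̄`-de Rham--Betti object `M`. -/
def GQbardRBOf (M : QbarDRBObj) : AlgebraicGeometry.Scheme.{1} :=
  TensorIso.scheme ((DRB.generated M).ι ⋙ DRB.omegaB Qbar Qbar)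
    ((DRB.generated M).ι ⋙ DRB.omegaB Qbar Qbar)

/-- The torsor of periods `Iso^⊗(ω_dR|⟨M⟩, ω_B|⟨M⟩)` of a `ℚ̄`-de Rham--Betti object `M`. -/
def OmegaQbardRBOf (M : QbarDRBObj) : AlgebraicGeometry.Scheme.{1} :=
  TensorIso.scheme ((DRB.generated M).ι ⋙ DRB.omegaDR Qbar Qbar)
    ((DRB.generated M).ι ⋙ DRB.omegaB Qbar Qbar)

end

end DeRhamBetti

namespace DeRhamBetti

noncomputable section

open CategoryTheory MonoidalCategory TensorProduct

set_option linter.unusedSectionVars false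

/-! ### Base change of subspaces -/

section LinearAlgebra

/-! An affine scheme is connected when its ring is nonzero and has no idempotents except 0 and 1, so
one has to show that an idempotent function on the torsor or on the group is constant. Let `K` be
`ℚ̄`, let `A` over `K` be the ring of the torsor and `A'` over `L` the ring of the group.

Every element of these rings is a matrix coefficient `x ↦ l (u x)` of the universal isomorphism on a
single object `X`: direct sums add coefficients, tensor products multiply them, and duals account
for the inverse (`exists_eq_coeff`). The comparison `c` is a complex point of the torsor, so it
gives homomorphisms in both directions between `ℂ ⊗ A` and `ℂ ⊗ A'` that exchange the coefficients
of `l` on `X.dR` and on `X.B` along `c`.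

Fix `X` and `l`. Over `ℂ`, the vectors whose coefficient lies in the linear span of the idempotents
form a subspace on either side, and `c` matches the two subspaces because algebra homomorphisms
preserve idempotents. Both are defined over the base fields: over an algebraically closed field the
span of the idempotents commutes with field extension (`idemSpan_baseChange`), and Galois descent
leads from `K` down to `L`. They therefore form a subobject `Y` of `X`
(`exists_compatible_submodules`).

The complex point `c` sends idempotents to 0 or 1, hence the span of the idempotents into `K`. So
the numbers `l (c y)` for `y` in `Y.dR` lie in `K`, which is exactly what makes `l` on `Y` a
morphism to the unit object (`exists_sub_hom_unit`). By naturality the coefficient of a vector of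
`Y` is then a scalar (`coeff_eq_algebraMap`), and an idempotent scalar is 0 or 1.

Only closure under the tensor operations and subquotients is needed of the class of objects, so the
whole category and `⟨M⟩` are treated together. -/

lemma mem_baseChange_ker {k R V W : Type*} [Field k] [CommRing R] [Algebra k R]
    [AddCommGroup V] [Module k V] [AddCommGroup W] [Module k W] (f : V →ₗ[k] W) (z : R ⊗[k] V) :
    z ∈ (LinearMap.ker f).baseChange R ↔ f.baseChange R z = 0 := by
  constructor
  · intro hz
    obtain ⟨y, rfl⟩ := (LinearMap.ker f).toBaseChange_surjective' R hz
    clear hz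
    induction y with
    | zero => simp
    | add x y hx hy => rw [map_add, Submodule.coe_add, map_add, hx, hy, add_zero]
    | tmul r s => rw [Submodule.coe_toBaseChange_tmul, LinearMap.baseChange_tmul, s.2, tmul_zero]
  · intro hz
    have hz' : z ∈ LinearMap.ker (AlgebraTensorModule.lTensor R R f) := hz
    rw [Module.Flat.ker_lTensor_eq] at hz'
    obtain ⟨y, rfl⟩ := hz'
    clear hz
    induction y with
    | zero => simp
    | add x y hx hy => rw [map_add]; exact add_mem hx hy
    | tmul r s => exact Submodule.tmul_mem_baseChange_of_mem r s.2

lemma mem_baseChange_iff_mkQ {k : Type*} (R : Type*) {A : Type*} [Field k] [CommRing R]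
    [Algebra k R] [AddCommGroup A] [Module k A] (S : Submodule k A) (z : R ⊗[k] A) :
    z ∈ S.baseChange R ↔ S.mkQ.baseChange R z = 0 := by
  rw [← mem_baseChange_ker, Submodule.ker_mkQ]

/-- Flatness: the preimage of `S` is the kernel of the map to `A / S`, and kernels commute with base
change. This moves the condition "the coefficient lies in the span of the idempotents" between base
fields. -/
lemma mem_baseChange_comap {k R V A : Type*} [Field k] [CommRing R]
    [Algebra k R] [AddCommGroup V] [Module k V] [AddCommGroup A] [Module k A]
    (f : V →ₗ[k] A) (S : Submodule k A) (z : R ⊗[k] V) :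
    z ∈ (S.comap f).baseChange R ↔ f.baseChange R z ∈ S.baseChange R := by
  rw [mem_baseChange_iff_mkQ R S, ← LinearMap.comp_apply, ← LinearMap.baseChange_comp,
    ← mem_baseChange_ker, LinearMap.ker_comp, Submodule.ker_mkQ]

/-- On a domain of finite type over an algebraically closed field, rational points separate
functions. -/
lemma exists_algHom_ne_zero {k R : Type*} [Field k] [IsAlgClosed k] [CommRing R] [IsReduced R]
    [Algebra k R] [Algebra.FiniteType k R] {r : R} (hr : r ≠ 0) : ∃ p : R →ₐ[k] k, p r ≠ 0 := by
  have : IsJacobsonRing R := isJacobsonRing_of_finiteType (A := k)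
  -- The ring is reduced and Jacobson, so its Jacobson radical is zero and some maximal ideal misses
  -- `r`. By the Nullstellensatz the residue field there is `k`.
  have h : r ∉ (⊥ : Ideal R).jacobson := by
    rw [IsJacobsonRing.out inferInstance Ideal.isRadical_bot]
    simpa using hr
  obtain ⟨m, ⟨-, hm⟩, hrm⟩ : ∃ m : Ideal R, (⊥ ≤ m ∧ m.IsMaximal) ∧ r ∉ m := by
    simpa [Ideal.jacobson, Submodule.mem_sInf] using h
  let := Ideal.Quotient.field m
  have := finite_of_finite_type_of_isJacobsonRing k (R ⧸ m)
  have hb := IsAlgClosed.algebraMap_bijective_of_isIntegral (k := k) (K := R ⧸ m)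
  let e : k ≃ₐ[k] R ⧸ m := AlgEquiv.ofBijective (Algebra.ofId k _) hb
  refine ⟨e.symm.toAlgHom.comp (Ideal.Quotient.mkₐ k m), fun h0 ↦ hrm ?_⟩
  have h1 : e.symm (Ideal.Quotient.mk m r) = 0 := h0
  rw [map_eq_zero_iff _ e.symm.injective] at h1
  exact Ideal.Quotient.eq_zero_iff_mem.1 h1

/-! ### Spans of idempotents and extension of the base field -/

variable (k A) in
/-- The linear span of the idempotents of an algebra. -/
def idemSpan (k A : Type*) [CommRing k] [CommRing A] [Algebra k A] : Submodule k A :=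
  Submodule.span k {a | IsIdempotentElem a}

/-- Evaluating `e` at a rational point of `R` gives an idempotent of `A`. The coordinates of `e` in
`A` modulo the span are thus elements of `R` that vanish at all rational points, hence are zero. -/
lemma mem_baseChange_idemSpan_of_finiteType {k R A : Type*} [Field k] [IsAlgClosed k] [CommRing R]
    [IsReduced R] [Algebra k R] [Algebra.FiniteType k R] [CommRing A] [Algebra k A] {e : R ⊗[k] A}
    (he : IsIdempotentElem e) : e ∈ (idemSpan k A).baseChange R := by
  rw [mem_baseChange_iff_mkQ]
  let b := Module.Free.chooseBasis k (A ⧸ idemSpan k A)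
  apply (b.baseChange R).repr.injective
  ext i
  rw [map_zero, Finsupp.zero_apply]
  by_contra hne
  obtain ⟨p, hp⟩ := exists_algHom_ne_zero (k := k) hne
  apply hp
  let ev : R ⊗[k] A →ₐ[k] A := Algebra.TensorProduct.lift ((Algebra.ofId k A).comp p)
    (AlgHom.id k A) fun _ _ ↦ Commute.all _ _
  have key (z : R ⊗[k] A) : p ((b.baseChange R).repr ((idemSpan k A).mkQ.baseChange R z) i) =
      b.repr ((idemSpan k A).mkQ (ev z)) i := by
    induction z with
    | zero => simp
    | add x y hx hy => simp only [map_add, Finsupp.add_apply, hx, hy]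
    | tmul r a =>
      have : ev (r ⊗ₜ a) = p r • a := by simp [ev, Algebra.smul_def, Algebra.ofId_apply]
      rw [this, map_smul, map_smul, Finsupp.smul_apply, LinearMap.baseChange_tmul,
        Module.Basis.baseChange_repr_tmul, map_smul, smul_eq_mul, smul_eq_mul, mul_comm]
  rw [key]
  have : ev e ∈ idemSpan k A := Submodule.subset_span (he.map ev)
  rw [(Submodule.Quotient.mk_eq_zero _).2 this |> fun h ↦ (h : (idemSpan k A).mkQ (ev e) = 0)]
  simp

lemma exists_map_inclusion_eq {k R A : Type*} [CommRing k] [CommRing R]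
    [Algebra k R] [AddCommGroup A] [Module k A] {R₀ R₁ : Subalgebra k R} (h : R₀ ≤ R₁)
    (w : R₀ ⊗[k] A) :
    ∃ w' : R₁ ⊗[k] A, R₁.val.toLinearMap.rTensor A w' = R₀.val.toLinearMap.rTensor A w := by
  refine ⟨(Subalgebra.inclusion h).toLinearMap.rTensor A w, ?_⟩
  rw [← LinearMap.comp_apply, ← LinearMap.rTensor_comp]
  rfl

/-- A tensor involves only finitely many elements of `R`; this reduces a large field to algebras of
finite type. -/
lemma exists_fg_subalgebra_rTensor {k R A : Type*} [CommRing k] [CommRing R]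
    [Algebra k R] [AddCommGroup A] [Module k A] (z : R ⊗[k] A) :
    ∃ (R₀ : Subalgebra k R) (_ : R₀.FG) (z₀ : R₀ ⊗[k] A),
      R₀.val.toLinearMap.rTensor A z₀ = z := by
  induction z with
  | zero => exact ⟨⊥, Subalgebra.fg_bot, 0, map_zero _⟩
  | tmul r a =>
    have hr : r ∈ Algebra.adjoin k ({r} : Set R) := Algebra.self_mem_adjoin_singleton k r
    generalize hS : Algebra.adjoin k ({r} : Set R) = S at hr
    exact ⟨S, ⟨{r}, by rw [Finset.coe_singleton, hS]⟩, ⟨r, hr⟩ ⊗ₜ a, rfl⟩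
  | add x y hx hy =>
    obtain ⟨S, hS, x, rfl⟩ := hx
    obtain ⟨T, hT, y, rfl⟩ := hy
    obtain ⟨x', hx⟩ := exists_map_inclusion_eq (le_sup_left : S ≤ S ⊔ T) x
    obtain ⟨y', hy⟩ := exists_map_inclusion_eq (le_sup_right : T ≤ S ⊔ T) y
    exact ⟨S ⊔ T, hS.sup hT, x' + y', by rw [map_add, hx, hy]⟩

/-- Over an algebraically closed field, base change to a field creates no new idempotents up to
linear combinations. -/
lemma mem_baseChange_idemSpan {k R A : Type*} [Field k] [IsAlgClosed k] [Field R]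
    [Algebra k R] [CommRing A] [Algebra k A] {e : R ⊗[k] A}
    (he : IsIdempotentElem e) : e ∈ (idemSpan k A).baseChange R := by
  obtain ⟨R₀, hR₀, e₀, rfl⟩ := exists_fg_subalgebra_rTensor e
  have : Algebra.FiniteType k R₀ := (Subalgebra.fg_iff_finiteType _).1 hR₀
  -- Flatness embeds `R₀ ⊗ A` in `R ⊗ A`, so idempotency is already visible over `R₀`, which is
  -- reduced as a subring of a field.
  have hinj : Function.Injective (Algebra.TensorProduct.map R₀.val (AlgHom.id k A)) :=
    Module.Flat.rTensor_preserves_injective_linearMap (M := A)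
      R₀.val.toLinearMap Subtype.val_injective
  have he₀ : IsIdempotentElem e₀ := hinj (by rw [map_mul]; exact he)
  obtain ⟨y, rfl⟩ := (idemSpan k A).toBaseChange_surjective' _
    (mem_baseChange_idemSpan_of_finiteType he₀)
  clear he he₀
  induction y with
  | zero => simp
  | add x y hx hy =>
    simp only [map_add, Submodule.coe_add]
    exact add_mem hx hy
  | tmul r a =>
    rw [Submodule.coe_toBaseChange_tmul, LinearMap.rTensor_tmul]
    exact Submodule.tmul_mem_baseChange_of_mem _ a.2

/-- The inclusion that uses algebraic closedness is the first one: over a general field, idempotents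
may appear that no combination of old ones yields, as in `ℂ ⊗[ℝ] ℂ`. -/
lemma idemSpan_baseChange {k R A : Type*} [Field k] [IsAlgClosed k] [Field R]
    [Algebra k R] [CommRing A] [Algebra k A] :
    idemSpan R (R ⊗[k] A) = (idemSpan k A).baseChange R := by
  apply le_antisymm
  · exact Submodule.span_le.2 fun e he ↦ mem_baseChange_idemSpan he
  · rw [idemSpan, Submodule.baseChange_span]
    refine Submodule.span_mono ?_
    rintro _ ⟨a, ha, rfl⟩
    exact ha.map (Algebra.TensorProduct.includeRight : A →ₐ[k] R ⊗[k] A)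

lemma map_mem_idemSpan {k A B : Type*} [CommRing k] [CommRing A] [Algebra k A] [CommRing B]
    [Algebra k B] (φ : A →ₐ[k] B) {a : A} (ha : a ∈ idemSpan k A) : φ a ∈ idemSpan k B := by
  induction ha using Submodule.span_induction with
  | mem x h => exact Submodule.subset_span (h.map φ)
  | zero => simp
  | add x y _ _ hx hy => rw [map_add]; exact add_mem hx hy
  | smul r x _ hx => rw [map_smul]; exact Submodule.smul_mem _ _ hx

/-- Galois descent for subspaces. -/
lemma galois_descent_submodule {k K V : Type*} [Field k] [Field K] [Algebra k K] [IsGalois k K]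
    [AddCommGroup V] [Module k V] (Z : Submodule K (K ⊗[k] V))
    (hZ : ∀ σ : K ≃ₐ[k] K, ∀ z ∈ Z, σ.toLinearMap.rTensor V z ∈ Z) :
    Z = ((Z.restrictScalars k).comap (TensorProduct.mk k K V 1)).baseChange K := by
  set Y := (Z.restrictScalars k).comap (TensorProduct.mk k K V 1)
  have hYZ : Y.baseChange K ≤ Z := by
    rw [Submodule.baseChange_eq_span, Submodule.span_le]
    rintro _ ⟨v, hv, rfl⟩
    exact hv
  refine le_antisymm ?_ hYZ
  let b := Module.Free.chooseBasis k V
  let B := b.baseChange K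
  have hB (σ : K ≃ₐ[k] K) (z : K ⊗[k] V) (i) :
      B.repr (σ.toLinearMap.rTensor V z) i = σ (B.repr z i) := by
    induction z with
    | zero => simp
    | add x y hx hy => simp only [map_add, Finsupp.add_apply, hx, hy]
    | tmul r a => simp [B, Module.Basis.baseChange_repr_tmul]
  -- a nonzero element of minimal support, normalised, is invariant
  have hmin (n : ℕ) : ∀ z ∈ Z, (B.repr z).support.card ≤ n → z ≠ 0 →
      ∃ v ∈ Y, v ≠ 0 ∧ (b.repr v).support ⊆ (B.repr z).support := by
    induction n with
    | zero =>
      intro z _ hc hz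
      simp only [nonpos_iff_eq_zero, Finset.card_eq_zero, Finsupp.support_eq_empty] at hc
      exact absurd ((LinearEquiv.map_eq_zero_iff _).1 hc) hz
    | succ n ih =>
      intro z hzZ hc hz
      obtain ⟨i, hi⟩ : ∃ i, B.repr z i ≠ 0 := by
        by_contra! h
        exact hz (B.repr.injective (Finsupp.ext (by simpa using h)))
      set w := (B.repr z i)⁻¹ • z with hw
      have hwZ : w ∈ Z := Z.smul_mem _ hzZ
      have hwi : B.repr w i = 1 := by simp [hw, hi]
      have hws : (B.repr w).support ⊆ (B.repr z).support := by
        rw [hw, map_smul]; exact Finsupp.support_smul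
      by_cases hinv : ∀ σ : K ≃ₐ[k] K, σ.toLinearMap.rTensor V w = w
      · have hmem (j) : B.repr w j ∈ Set.range (algebraMap k K) := by
          rw [InfiniteGalois.mem_range_algebraMap_iff_fixed]
          intro σ
          rw [← hB, hinv]
        choose g hg using hmem
        have hg0 (j) : g j = 0 ↔ B.repr w j = 0 := by
          rw [← hg]; exact (map_eq_zero_iff _ (algebraMap k K).injective).symm
        -- The coordinates of `w` are Galois invariant, hence lie in `k`. `invFun` pulls them back
        -- as one function that fixes 0, so that the support stays finite.
        let v : V := b.repr.symm ((B.repr w).mapRange (fun x ↦ (Function.invFun (algebraMap k K) x))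
          (by
            have := Function.leftInverse_invFun (algebraMap k K).injective 0
            simpa using this))
        have hv (j) : b.repr v j = g j := by
          simp only [v, LinearEquiv.apply_symm_apply, Finsupp.mapRange_apply]
          rw [← hg]
          exact Function.leftInverse_invFun (algebraMap k K).injective (g j)
        have hvw : (1 : K) ⊗ₜ[k] v = w := by
          apply B.repr.injective
          ext j
          rw [Module.Basis.baseChange_repr_tmul, hv, ← hg, Algebra.smul_def, mul_one]
        refine ⟨v, ?_, ?_, ?_⟩
        · change (1 : K) ⊗ₜ[k] v ∈ Z
          rwa [hvw]
        · intro hv0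
          rw [hv0, tmul_zero] at hvw
          rw [← hvw] at hwi
          simp at hwi
        · intro j hj
          refine hws ?_
          simp only [Finsupp.mem_support_iff, hv, ne_eq, hg0] at hj ⊢
          exact hj
      · push Not at hinv
        obtain ⟨σ, hσ⟩ := hinv
        -- Since `σ` fixes the coordinate 1 at `i`, that coordinate cancels in `u`, and no new one
        -- enters the support.
        set u := σ.toLinearMap.rTensor V w - w
        have hu : (B.repr u).support ⊆ (B.repr z).support.erase i := by
          intro j hj
          simp only [u, Finsupp.mem_support_iff, map_sub, Finsupp.sub_apply, hB] at hj
          rw [Finset.mem_erase]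
          constructor
          · rintro rfl
            simp [hwi] at hj
          · refine hws ?_
            rw [Finsupp.mem_support_iff]
            intro h0
            simp [h0] at hj
        obtain ⟨v, hv, hv0, hvs⟩ := ih u (Z.sub_mem (hZ σ w hwZ) hwZ) (by
          have := Finset.card_le_card hu
          rw [Finset.card_erase_of_mem (by simpa using hi)] at this
          omega) (sub_ne_zero.2 hσ)
        exact ⟨v, hv, hv0, hvs.trans (hu.trans (Finset.erase_subset _ _))⟩
  -- Second induction on the support: a multiple of an invariant vector supported inside that of `z`
  -- cancels one coordinate of `z`.
  suffices h : ∀ n : ℕ, ∀ z ∈ Z, (B.repr z).support.card ≤ n → z ∈ Y.baseChange K from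
    fun z hz ↦ h _ z hz le_rfl
  intro n
  induction n with
  | zero =>
    intro z _ hc
    simp only [nonpos_iff_eq_zero, Finset.card_eq_zero, Finsupp.support_eq_empty] at hc
    rw [(LinearEquiv.map_eq_zero_iff _).1 hc]
    exact zero_mem _
  | succ n ih =>
    intro z hz hc
    by_cases hz0 : z = 0
    · rw [hz0]; exact zero_mem _
    obtain ⟨v, hv, hv0, hvs⟩ := hmin _ z hz le_rfl hz0
    obtain ⟨i, hi⟩ : ∃ i, b.repr v i ≠ 0 := by
      by_contra! h
      exact hv0 (b.repr.injective (Finsupp.ext (by simpa using h)))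
    have hvY : (1 : K) ⊗ₜ[k] v ∈ Y.baseChange K := Submodule.tmul_mem_baseChange_of_mem 1 hv
    set a : K := B.repr z i * (algebraMap k K (b.repr v i))⁻¹
    set u := z - a • ((1 : K) ⊗ₜ[k] v) with hudef
    have hrep (j) : B.repr u j = B.repr z j - a * algebraMap k K (b.repr v j) := by
      simp [u, B, Module.Basis.baseChange_repr_tmul, Algebra.smul_def, a, mul_assoc]
    have hu : (B.repr u).support ⊆ (B.repr z).support.erase i := by
      intro j hj
      rw [Finsupp.mem_support_iff, hrep] at hj
      rw [Finset.mem_erase]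
      constructor
      · rintro rfl
        apply hj
        have : algebraMap k K (b.repr v j) ≠ 0 := by simpa using hi
        simp [a, this]
      · by_contra h
        have h2 : b.repr v j = 0 := by
          by_contra h3
          exact h (hvs (by simpa using h3))
        rw [Finsupp.notMem_support_iff] at h
        simp [h, h2] at hj
    have := ih u (Z.sub_mem hz (Z.smul_mem _ (hYZ hvY))) (by
      have := Finset.card_le_card hu
      rw [Finset.card_erase_of_mem (hvs (by simpa using hi))] at this
      omega)
    have h3 := add_mem this ((Y.baseChange K).smul_mem a hvY)
    rwa [hudef, sub_add_cancel] at h3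

end LinearAlgebra

/-! ### Descent of the idempotent condition; connectedness through idempotents -/

section Descent

lemma baseChange_baseChange_map_cancelBaseChange {L K R W : Type*} [Field L] [Field K] [CommRing R]
    [Algebra L K] [Algebra K R] [Algebra L R] [IsScalarTower L K R]
    [AddCommGroup W] [Module L W] (Y : Submodule L W) :
    ((Y.baseChange K).baseChange R).map
      (AlgebraTensorModule.cancelBaseChange L K R R W).toLinearMap = Y.baseChange R := by
  rw [Submodule.baseChange_eq_span (A := K), Submodule.baseChange_span, Submodule.map_span,
    Submodule.baseChange_eq_span]
  congr 1
  ext z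
  constructor
  · rintro ⟨_, ⟨_, ⟨w, hw, rfl⟩, rfl⟩, rfl⟩
    exact ⟨w, hw, by simp⟩
  · rintro ⟨w, hw, rfl⟩
    exact ⟨_, ⟨_, ⟨w, hw, rfl⟩, rfl⟩, by simp⟩

/-- The map is a ring homomorphism, so it preserves idempotents, and it is `σ`-semilinear, so it
preserves their `K`-span. This is the stability that Galois descent asks for. -/
lemma rTensor_mem_idemSpan {k K A : Type*} [Field k] [Field K] [Algebra k K] [CommRing A]
    [Algebra k A] (σ : K ≃ₐ[k] K) {z : K ⊗[k] A} (hz : z ∈ idemSpan K (K ⊗[k] A)) :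
    σ.toLinearMap.rTensor A z ∈ idemSpan K (K ⊗[k] A) := by
  let s : K ⊗[k] A →ₐ[k] K ⊗[k] A := Algebra.TensorProduct.map σ.toAlgHom (AlgHom.id k A)
  have hs (z) : s z = σ.toLinearMap.rTensor A z := rfl
  have hsmul (r : K) (x) : s (r • x) = σ r • s x := by
    induction x with
    | zero => simp
    | add x y hx hy => simp only [smul_add, map_add, hx, hy]
    | tmul a b => simp [s, smul_tmul']
  rw [← hs]
  induction hz using Submodule.span_induction with
  | mem x h => exact Submodule.subset_span (h.map s)
  | zero => simp
  | add x y _ _ hx hy => rw [map_add]; exact add_mem hx hy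
  | smul r x _ hx => rw [hsmul]; exact Submodule.smul_mem _ _ hx

/-- The subspace of those vectors that a linear map to an algebra sends to combinations of
idempotents, after extension to a field containing a Galois, algebraically closed extension, is
defined over the ground field. -/
lemma exists_submodule_baseChange_eq_comap_idemSpan {L K R W A : Type*} [Field L] [Field K]
    [Field R] [Algebra L K] [Algebra K R] [Algebra L R] [IsScalarTower L K R] [IsAlgClosed K]
    [IsGalois L K] [AddCommGroup W] [Module L W] [CommRing A] [Algebra L A] (f : W →ₗ[L] A) :
    ∃ Y : Submodule L W,
      (∀ z, z ∈ Y.baseChange R ↔ f.baseChange R z ∈ idemSpan R (R ⊗[L] A)) ∧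
      ∀ w, IsIdempotentElem (f w) → w ∈ Y := by
  set Z := (idemSpan K (K ⊗[L] A)).comap (f.baseChange K) with hZdef
  have hZ := galois_descent_submodule Z fun σ z hz ↦ by
    have : f.baseChange K (σ.toLinearMap.rTensor W z) =
        σ.toLinearMap.rTensor A (f.baseChange K z) := by
      induction z with
      | zero => simp
      | add x y hx hy =>
        -- The induction carries along membership in `Z`, which does not pass to summands, so its
        -- hypotheses are of no use; the identity is proved for all vectors at once.
        clear hx hy
        exact LinearMap.congr_fun (f := f.lTensor K ∘ₗ σ.toLinearMap.rTensor W)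
          (g := σ.toLinearMap.rTensor A ∘ₗ f.lTensor K)
          (TensorProduct.ext' fun _ _ ↦ by simp) (x + y)
      | tmul a b => simp
    rw [hZdef, Submodule.mem_comap, this]
    exact rTensor_mem_idemSpan σ hz
  set Y := (Z.restrictScalars L).comap (TensorProduct.mk L K W 1)
  refine ⟨Y, fun z ↦ ?_, fun w hw ↦ ?_⟩
  · obtain ⟨u, rfl⟩ := (AlgebraTensorModule.cancelBaseChange L K R R W).surjective z
    -- From here the extension from `L` to `R` is made in two stages: descent handles `L` to `K`,
    -- and `idemSpan_baseChange` handles `K` to `R`.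
    rw [← baseChange_baseChange_map_cancelBaseChange (K := K), ← hZ]
    have h1 : (AlgebraTensorModule.cancelBaseChange L K R R W) u ∈
        (Z.baseChange R).map (AlgebraTensorModule.cancelBaseChange L K R R W).toLinearMap ↔
        u ∈ Z.baseChange R :=
      ⟨fun ⟨v, hv, h⟩ ↦ (AlgebraTensorModule.cancelBaseChange L K R R W).injective h ▸ hv,
        fun h ↦ ⟨_, h, rfl⟩⟩
    rw [h1, hZdef, mem_baseChange_comap, ← idemSpan_baseChange]
    let e := Algebra.TensorProduct.cancelBaseChange L K R R A
    have h2 : f.baseChange R (AlgebraTensorModule.cancelBaseChange L K R R W u) =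
        e ((f.baseChange K).baseChange R u) := by
      induction u with
      | zero => simp
      | add x y hx hy => simp_all
      | tmul r v =>
        induction v with
        | zero => simp
        | add x y hx hy => simp_all [tmul_add]
        | tmul a b => simp [e]
    rw [h2]
    refine ⟨map_mem_idemSpan e.toAlgHom, fun h ↦ ?_⟩
    simpa using map_mem_idemSpan e.symm.toAlgHom h
  · change f.baseChange K (1 ⊗ₜ w) ∈ idemSpan K (K ⊗[L] A)
    rw [LinearMap.baseChange_tmul]
    exact Submodule.subset_span
      (hw.map (Algebra.TensorProduct.includeRight : A →ₐ[L] K ⊗[L] A))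

/-- `Φ` and `Ψ` preserve spans of idempotents, so the two conditions agree over `R` along `c`. The
field `K` is algebraically closed, so `Y` is a plain preimage; over `L` the span has to be formed
over `K` and descended, and therefore only one implication is kept for `Y'`. -/
lemma exists_compatible_submodules {L K R V W A A' : Type*} [Field L] [Field K]
    [Field R] [Algebra L K] [Algebra K R] [Algebra L R] [IsScalarTower L K R] [IsAlgClosed K]
    [IsGalois L K] [AddCommGroup V] [Module K V] [AddCommGroup W] [Module L W]
    [CommRing A] [Algebra K A] [CommRing A'] [Algebra L A']
    (c : R ⊗[K] V ≃ₗ[R] R ⊗[L] W) (f : V →ₗ[K] A) (f' : W →ₗ[L] A')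
    (Φ : R ⊗[K] A →ₐ[R] R ⊗[L] A') (Ψ : R ⊗[L] A' →ₐ[R] R ⊗[K] A)
    (hΦ : ∀ z, Φ (f.baseChange R z) = f'.baseChange R (c z))
    (hΨ : ∀ z, Ψ (f'.baseChange R (c z)) = f.baseChange R z) :
    ∃ (Y : Submodule K V) (Y' : Submodule L W),
      (∀ z, c z ∈ Y'.baseChange R ↔ z ∈ Y.baseChange R) ∧ (∀ x, x ∈ Y ↔ f x ∈ idemSpan K A) ∧
      ∀ w, IsIdempotentElem (f' w) → w ∈ Y' := by
  obtain ⟨Y', h1, h2⟩ := exists_submodule_baseChange_eq_comap_idemSpan (K := K) (R := R) f'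
  refine ⟨(idemSpan K A).comap f, Y', fun z ↦ ?_, fun x ↦ Iff.rfl, h2⟩
  rw [h1, mem_baseChange_comap, ← idemSpan_baseChange]
  exact ⟨fun h ↦ hΨ z ▸ map_mem_idemSpan Ψ h, fun h ↦ hΦ z ▸ map_mem_idemSpan Φ h⟩

/-- Clopen subsets of a prime spectrum are the basic open sets of idempotents. -/
lemma connectedSpace_primeSpectrum {A : Type*} [CommRing A] [Nontrivial A]
    (h : ∀ e : A, IsIdempotentElem e → e = 0 ∨ e = 1) : ConnectedSpace (PrimeSpectrum A) := by
  have : PreconnectedSpace (PrimeSpectrum A) := by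
    rw [preconnectedSpace_iff_clopen]
    intro s hs
    obtain ⟨e, he, rfl⟩ := PrimeSpectrum.exists_idempotent_basicOpen_eq_of_isClopen hs
    obtain rfl | rfl := h e he
    · left; simp
    · right; simp
  exact ⟨inferInstance⟩

end Descent

/-! ### Linear forms after extension of scalars -/

section EvalDual

/-- The `R`-linear extension `W_R → R` of a linear form on `W`. -/
def evalDual {k : Type*} (R : Type*) {W : Type*} [CommRing k] [CommRing R] [Algebra k R]
    [AddCommGroup W] [Module k W] (l : Module.Dual k W) : R ⊗[k] W →ₗ[R] R :=
  (AlgebraTensorModule.rid k R R).toLinearMap ∘ₗ LinearMap.baseChange R l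

variable {k R W : Type*} [CommRing k] [CommRing R] [Algebra k R] [AddCommGroup W] [Module k W]

@[simp] lemma evalDual_tmul (l : Module.Dual k W) (r : R) (w : W) :
    evalDual R l (r ⊗ₜ w) = l w • r := by simp [evalDual]

lemma evalDual_map {V : Type*} [AddCommGroup V] [Module k V] (l : Module.Dual k W)
    (f : V →ₗ[k] W) (a : R ⊗[k] V) :
    evalDual R l (f.baseChange R a) = evalDual R (l ∘ₗ f) a := by
  induction a with
  | zero => simp
  | add x y hx hy => simp only [map_add, hx, hy]
  | tmul r v => simp

lemma evalDual_bc {k : Type} {S : Type*} [Field k] [Algebra k R] [Module k W] [CommRing S] [Algebra k S]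
    (φ : R →ₐ[k] S) (l : Module.Dual k W) (a : R ⊗[k] W) :
    evalDual S l (bc φ W a) = φ (evalDual R l a) := by
  induction a with
  | zero => simp
  | add x y hx hy => simp only [map_add, hx, hy]
  | tmul r v => simp

end EvalDual

-- Isomorphisms of tensor functors over two base fields and their matrix coefficients

universe u v w

open Functor.LaxMonoidal

lemma tensorMul_tmul {E : Type} [Field E] {C : Type u} [Category.{v} C] [MonoidalCategory C]
    (F : C ⥤ ModuleCat.{0} E) [F.LaxMonoidal] (R : Type w) [CommRing R] [Algebra E R]
    (X Y : C) (r s : R) (x : F.obj X) (y : F.obj Y) :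
    tensorMul F R X Y (r ⊗ₜ x) (s ⊗ₜ y) = (r * s) ⊗ₜ (μ F X Y).hom (x ⊗ₜ[E] y) := by
  simp [tensorMul, bcMul_tmul]

lemma bc_tensorMul' {E : Type} [Field E] {C : Type u} [Category.{v} C] [MonoidalCategory C]
    (F : C ⥤ ModuleCat.{0} E) [F.LaxMonoidal] {R S : Type*} [CommRing R] [Algebra E R]
    [CommRing S] [Algebra E S] (φ : R →ₐ[E] S) (X Y : C) (a : R ⊗[E] F.obj X)
    (b : R ⊗[E] F.obj Y) :
    bc φ _ (tensorMul F R X Y a b) = tensorMul F S X Y (bc φ _ a) (bc φ _ b) :=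
  (TensorIso.bc_baseChange φ (μ F X Y).hom _).trans (congrArg _ (TensorIso.bc_bcMul φ a b))

/-- Isomorphisms, over a common algebra `R` of two fields, between the restrictions to a class of
objects of two tensor functors with values in vector spaces over the two fields. -/
structure MixedIso {k₁ k₂ : Type} [Field k₁] [Field k₂] {D : Type u} [Category.{v} D]
    [MonoidalCategory D] (P : ObjectProperty D) (F : D ⥤ ModuleCat.{0} k₁)
    (G : D ⥤ ModuleCat.{0} k₂) [F.LaxMonoidal] [G.LaxMonoidal]
    (R : Type w) [CommRing R] [Algebra k₁ R] [Algebra k₂ R] where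
  app (X : D) (hX : P X) : R ⊗[k₁] F.obj X ≃ₗ[R] R ⊗[k₂] G.obj X
  naturality {X Y : D} (hX : P X) (hY : P Y) (f : X ⟶ Y) (a : R ⊗[k₁] F.obj X) :
    app Y hY ((F.map f).hom.baseChange R a) = (G.map f).hom.baseChange R (app X hX a)
  unit (h : P (𝟙_ D)) :
    app (𝟙_ D) h (1 ⊗ₜ (ε F).hom (1 : k₁)) = 1 ⊗ₜ (ε G).hom (1 : k₂)
  tensor (X Y : D) (hX : P X) (hY : P Y) (h : P (X ⊗ Y)) (a : R ⊗[k₁] F.obj X)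
    (b : R ⊗[k₁] F.obj Y) :
    app (X ⊗ Y) h (tensorMul F R X Y a b) = tensorMul G R X Y (app X hX a) (app Y hY b)

namespace MixedIso

variable {k₁ k₂ k₃ : Type} [Field k₁] [Field k₂] [Field k₃] {D : Type u} [Category.{v} D]
    [MonoidalCategory D] {P : ObjectProperty D} {F : D ⥤ ModuleCat.{0} k₁}
    {G : D ⥤ ModuleCat.{0} k₂} {H : D ⥤ ModuleCat.{0} k₃} [F.LaxMonoidal] [G.LaxMonoidal]
    [H.LaxMonoidal] {R : Type w} [CommRing R] [Algebra k₁ R] [Algebra k₂ R] [Algebra k₃ R]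

/-- A constructor checking the axioms on vectors defined over the base field only. -/
def ofVectors (app : ∀ (X : D), P X → (R ⊗[k₁] F.obj X ≃ₗ[R] R ⊗[k₂] G.obj X))
    (nat : ∀ {X Y : D} (hX : P X) (hY : P Y) (f : X ⟶ Y) (x : F.obj X),
      app Y hY (1 ⊗ₜ (F.map f).hom x) = (G.map f).hom.baseChange R (app X hX (1 ⊗ₜ x)))
    (unit : ∀ h : P (𝟙_ D),
      app (𝟙_ D) h (1 ⊗ₜ (ε F).hom (1 : k₁)) = 1 ⊗ₜ (ε G).hom (1 : k₂))
    (tensor : ∀ (X Y : D) (hX : P X) (hY : P Y) (h : P (X ⊗ Y)) (x : F.obj X) (y : F.obj Y),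
      app (X ⊗ Y) h (1 ⊗ₜ (μ F X Y).hom (x ⊗ₜ[k₁] y)) =
        tensorMul G R X Y (app X hX (1 ⊗ₜ x)) (app Y hY (1 ⊗ₜ y))) :
    MixedIso P F G R where
  app := app
  naturality hX hY f a := by
    induction a with
    | zero => simp
    | add x y hx hy => simp only [map_add, hx, hy]
    | tmul r x =>
      have := congrArg (r • ·) (nat hX hY f x)
      simpa [← map_smul, smul_tmul'] using this
  unit := unit
  tensor X Y hX hY h a b := by
    induction a with
    | zero => simp
    | add x y hx hy => simp only [map_add, LinearMap.add_apply, hx, hy]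
    | tmul r x =>
      induction b with
      | zero => simp
      | add x y hx hy => simp only [map_add, hx, hy]
      | tmul s y =>
        have hr : r ⊗ₜ[k₁] x = r • (1 ⊗ₜ x) := by simp [smul_tmul']
        have hs : s ⊗ₜ[k₁] y = s • (1 ⊗ₜ y) := by simp [smul_tmul']
        rw [hr, hs]
        simp only [map_smul, LinearMap.smul_apply]
        rw [tensorMul_tmul, one_mul, tensor X Y hX hY]

/-- The inverse isomorphism. -/
def symm (g : MixedIso P F G R) : MixedIso P G F R where
  app X hX := (g.app X hX).symm
  naturality hX hY f a := by
    rw [LinearEquiv.symm_apply_eq, g.naturality hX hY, LinearEquiv.apply_symm_apply]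
  unit h := by rw [LinearEquiv.symm_apply_eq, g.unit]
  tensor X Y hX hY h a b := by
    rw [LinearEquiv.symm_apply_eq, g.tensor X Y hX hY, LinearEquiv.apply_symm_apply,
      LinearEquiv.apply_symm_apply]

/-- The composition of two isomorphisms. -/
def trans (g : MixedIso P F G R) (h : MixedIso P G H R) : MixedIso P F H R where
  app X hX := (g.app X hX).trans (h.app X hX)
  naturality hX hY f a := by simp [g.naturality hX hY, h.naturality hX hY]
  unit hu := by simp [g.unit, h.unit]
  tensor X Y hX hY hXY a b := by simp [g.tensor X Y hX hY, h.tensor X Y hX hY]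

/-- The identity. -/
def refl (P : ObjectProperty D) (F : D ⥤ ModuleCat.{0} k₁) [F.LaxMonoidal] (R : Type w)
    [CommRing R] [Algebra k₁ R] : MixedIso P F F R where
  app _ _ := .refl R _
  naturality _ _ _ _ := rfl
  unit _ := rfl
  tensor _ _ _ _ _ _ _ := rfl

section BaseChange

variable (S : Type*) [CommRing S] [Algebra R S] [Algebra k₁ S] [Algebra k₂ S]
  [IsScalarTower k₁ R S] [IsScalarTower k₂ R S]

lemma cancelBaseChange_tmul_eq_bc {k : Type} {V : Type*} [Field k] [Algebra k R] [Algebra k S]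
    [IsScalarTower k R S] [AddCommGroup V] [Module k V] (a : R ⊗[k] V) :
    AlgebraTensorModule.cancelBaseChange k R S S V (1 ⊗ₜ a) =
      bc (IsScalarTower.toAlgHom k R S) V a := by
  induction a with
  | zero => simp
  | add x y hx hy => simp only [map_add, tmul_add, hx, hy]
  | tmul r v => simp [Algebra.smul_def]

/-- The components of a base change. -/
def baseChangeApp {V W : Type*} [AddCommGroup V] [Module k₁ V] [AddCommGroup W] [Module k₂ W]
    (e : R ⊗[k₁] V ≃ₗ[R] R ⊗[k₂] W) : S ⊗[k₁] V ≃ₗ[S] S ⊗[k₂] W :=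
  (AlgebraTensorModule.cancelBaseChange k₁ R S S V).symm ≪≫ₗ e.baseChange R S _ _ ≪≫ₗ
    AlgebraTensorModule.cancelBaseChange k₂ R S S W

lemma baseChangeApp_bc {V W : Type*} [AddCommGroup V] [Module k₁ V] [AddCommGroup W]
    [Module k₂ W] (e : R ⊗[k₁] V ≃ₗ[R] R ⊗[k₂] W) (a : R ⊗[k₁] V) :
    baseChangeApp S e (bc (IsScalarTower.toAlgHom k₁ R S) V a) =
      bc (IsScalarTower.toAlgHom k₂ R S) W (e a) := by
  rw [← cancelBaseChange_tmul_eq_bc, ← cancelBaseChange_tmul_eq_bc]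
  simp [baseChangeApp]

lemma baseChangeApp_tmul {V W : Type*} [AddCommGroup V] [Module k₁ V] [AddCommGroup W]
    [Module k₂ W] (e : R ⊗[k₁] V ≃ₗ[R] R ⊗[k₂] W) (v : V) :
    baseChangeApp S e (1 ⊗ₜ v) = bc (IsScalarTower.toAlgHom k₂ R S) W (e (1 ⊗ₜ v)) := by
  rw [← baseChangeApp_bc]
  simp

/-- Extension of scalars. -/
def baseChange (g : MixedIso P F G R) : MixedIso P F G S :=
  ofVectors (fun X hX ↦ baseChangeApp S (g.app X hX))
    (fun hX hY f x ↦ by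
      rw [baseChangeApp_tmul, baseChangeApp_tmul, ← TensorIso.bc_baseChange, ← g.naturality hX hY]
      rfl)
    (fun h ↦ by
      rw [baseChangeApp_tmul, g.unit]
      simp)
    (fun X Y hX hY h x y ↦ by
      rw [baseChangeApp_tmul, baseChangeApp_tmul, baseChangeApp_tmul, ← bc_tensorMul',
        ← g.tensor X Y hX hY h, tensorMul_tmul, one_mul])

end BaseChange

/-- The matrix coefficients `x ↦ l (g x)`. -/
def coeff (g : MixedIso P F G R) (X : D) (hX : P X) (l : Module.Dual k₂ (G.obj X)) :
    F.obj X →ₗ[k₁] R :=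
  (evalDual R l ∘ₗ (g.app X hX).toLinearMap).restrictScalars k₁ ∘ₗ
    TensorProduct.mk k₁ R (F.obj X) 1

lemma coeff_apply (g : MixedIso P F G R) (X : D) (hX : P X) (l : Module.Dual k₂ (G.obj X))
    (x : F.obj X) : g.coeff X hX l x = evalDual R l (g.app X hX (1 ⊗ₜ x)) := rfl

lemma coeff_map (g : MixedIso P F G R) {X Y : D} (hX : P X) (hY : P Y) (f : X ⟶ Y)
    (l : Module.Dual k₂ (G.obj Y)) (x : F.obj X) :
    g.coeff Y hY l ((F.map f).hom x) = g.coeff X hX (l ∘ₗ (G.map f).hom) x := by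
  rw [coeff_apply, coeff_apply, ← evalDual_map, ← g.naturality hX hY]
  rfl

lemma evalDual_tensorMul {X Y : D} {l : Module.Dual k₂ (G.obj X)} {m : Module.Dual k₂ (G.obj Y)}
    {n : Module.Dual k₂ (G.obj (X ⊗ Y))}
    (h : ∀ x y, n ((μ G X Y).hom (x ⊗ₜ[k₂] y)) = l x * m y) (a : R ⊗[k₂] G.obj X)
    (b : R ⊗[k₂] G.obj Y) :
    evalDual R n (tensorMul G R X Y a b) = evalDual R l a * evalDual R m b := by
  induction a with
  | zero => simp
  | add x y hx hy => simp only [map_add, LinearMap.add_apply, hx, hy, add_mul]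
  | tmul r x =>
    induction b with
    | zero => simp
    | add x y hx hy => simp only [map_add, hx, hy, mul_add]
    | tmul s y => rw [tensorMul_tmul]; simp [h, smul_smul, mul_comm]

/-- Since `g` respects tensor products, coefficients on `X ⊗ Y` of product forms are products; this
makes the set of coefficients closed under multiplication. -/
lemma coeff_tensor (g : MixedIso P F G R) {X Y : D} (hX : P X) (hY : P Y) (hXY : P (X ⊗ Y))
    {l : Module.Dual k₂ (G.obj X)} {m : Module.Dual k₂ (G.obj Y)}
    {n : Module.Dual k₂ (G.obj (X ⊗ Y))}
    (h : ∀ x y, n ((μ G X Y).hom (x ⊗ₜ[k₂] y)) = l x * m y) (x : F.obj X) (y : F.obj Y) :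
    g.coeff (X ⊗ Y) hXY n ((μ F X Y).hom (x ⊗ₜ[k₁] y)) =
      g.coeff X hX l x * g.coeff Y hY m y := by
  rw [coeff_apply, coeff_apply, coeff_apply, ← evalDual_tensorMul h, ← g.tensor X Y hX hY hXY,
    tensorMul_tmul, one_mul]

lemma coeff_unit (g : MixedIso P F G R) (h : P (𝟙_ D)) {l : Module.Dual k₂ (G.obj (𝟙_ D))}
    (hl : l ((ε G).hom (1 : k₂)) = 1) : g.coeff _ h l ((ε F).hom (1 : k₁)) = 1 := by
  rw [coeff_apply, g.unit, evalDual_tmul, hl, one_smul]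

/-- Coefficients of the inverse in terms of coefficients on the dual. -/
lemma evalDual_symm_app (g : MixedIso P F G R) (h1 : P (𝟙_ D)) {X X' : D} (hX : P X) (hX' : P X')
    (hXX' : P (X' ⊗ X)) (ev : X' ⊗ X ⟶ 𝟙_ D) {φ : Module.Dual k₁ (F.obj X)} {x' : F.obj X'}
    (hF : ∀ x, (F.map ev).hom ((μ F X' X).hom (x' ⊗ₜ[k₁] x)) = (ε F).hom (φ x))
    {y : G.obj X} {l : Module.Dual k₂ (G.obj X')}
    (hG : ∀ y', (G.map ev).hom ((μ G X' X).hom (y' ⊗ₜ[k₂] y)) = (ε G).hom (l y'))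
    {η : Module.Dual k₂ (G.obj (𝟙_ D))} (hη : η ((ε G).hom (1 : k₂)) = 1) :
    evalDual R φ ((g.app X hX).symm (1 ⊗ₜ y)) = g.coeff X' hX' l x' := by
  have h2 (a : R ⊗[k₁] F.obj X) :
      (F.map ev).hom.baseChange R (tensorMul F R X' X (1 ⊗ₜ x') a) =
        evalDual R φ a • (1 ⊗ₜ (ε F).hom (1 : k₁)) := by
    induction a with
    | zero => simp
    | add x y hx hy => simp only [map_add, hx, hy, add_smul]
    | tmul r x =>
      rw [tensorMul_tmul, LinearMap.baseChange_tmul, hF, one_mul, evalDual_tmul]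
      have : (ε F).hom (φ x) = φ x • (ε F).hom (1 : k₁) := by
        rw [← map_smul, smul_eq_mul, mul_one]
      rw [this, tmul_smul, smul_tmul', smul_tmul', smul_eq_mul, mul_one]
  have h3 (b : R ⊗[k₂] G.obj X') :
      (G.map ev).hom.baseChange R (tensorMul G R X' X b (1 ⊗ₜ y)) =
        evalDual R l b • (1 ⊗ₜ (ε G).hom (1 : k₂)) := by
    induction b with
    | zero => simp
    | add x y hx hy => simp only [map_add, LinearMap.add_apply, hx, hy, add_smul]
    | tmul r x =>
      rw [tensorMul_tmul, LinearMap.baseChange_tmul, hG, mul_one, evalDual_tmul]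
      have : (ε G).hom (l x) = l x • (ε G).hom (1 : k₂) := by
        rw [← map_smul, smul_eq_mul, mul_one]
      rw [this, tmul_smul, smul_tmul', smul_tmul', smul_eq_mul, mul_one]
  -- Invariance of the evaluation pairing under `g`, applied to `x'` and to the preimage of `y`:
  -- pairing before `g` gives the left side of the claim, pairing after `g` the right side.
  have h4 := g.naturality hXX' h1 ev (tensorMul F R X' X (1 ⊗ₜ x') ((g.app X hX).symm (1 ⊗ₜ y)))
  rw [h2, g.tensor X' X hX' hX, LinearEquiv.apply_symm_apply, h3, map_smul, g.unit] at h4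
  have h5 := congrArg (evalDual R η) h4
  rw [map_smul, map_smul, evalDual_tmul, hη, one_smul, smul_eq_mul, smul_eq_mul, mul_one,
    mul_one] at h5
  exact h5

/-- A coefficient that factors through a morphism to the unit object is constant. -/
lemma coeff_eq_algebraMap (g : MixedIso P F G R) (h1 : P (𝟙_ D)) {X Y : D} (hX : P X) (hY : P Y)
    (i : Y ⟶ X) (p : Y ⟶ 𝟙_ D) {l : Module.Dual k₂ (G.obj X)} {y : F.obj Y} {t : k₁}
    (ht : (F.map p).hom y = (ε F).hom t)
    (hl : ∀ w, (G.map p).hom w = (ε G).hom (l ((G.map i).hom w)))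
    {η : Module.Dual k₂ (G.obj (𝟙_ D))} (hη : η ((ε G).hom (1 : k₂)) = 1) :
    g.coeff X hX l ((F.map i).hom y) = algebraMap k₁ R t := by
  -- On `Y` the form `l` is the pullback of the coordinate `η` of the unit object, so naturality
  -- along `i` and then along `p` moves the coefficient to the unit, where `g` is the identity.
  have h2 : l ∘ₗ (G.map i).hom = η ∘ₗ (G.map p).hom := by
    ext w
    have h3 : (ε G).hom (l ((G.map i).hom w)) =
        l ((G.map i).hom w) • (ε G).hom (1 : k₂) := by
      rw [← map_smul, smul_eq_mul, mul_one]
    simp only [LinearMap.comp_apply]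
    rw [hl, h3, map_smul, hη, smul_eq_mul, mul_one]
  rw [g.coeff_map hY hX, h2, ← g.coeff_map hY h1, ht]
  have h4 : (ε F).hom t = t • (ε F).hom (1 : k₁) := by
    rw [← map_smul, smul_eq_mul, mul_one]
  rw [h4, map_smul, g.coeff_unit h1 hη, Algebra.smul_def, mul_one]

end MixedIso

/-! ### Tensor operations on objects and matrix coefficients -/

namespace DRB

variable {K L : Type} [Field K] [Field L] [Algebra K ℂ] [Algebra L ℂ]

/-- The inclusion of the first summand. -/
def inl (X Y : DRB K L) : X ⟶ directSum X Y :=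
  (⟨LinearMap.inl K X.dR Y.dR, LinearMap.inl L X.B Y.B, fun z ↦ by
    induction z with
    | zero => simp
    | add x y hx hy => simp only [map_add, hx, hy]
    | tmul r x =>
      have h (w : ℂ ⊗[L] X.B) : (TensorProduct.prodRight L ℂ ℂ X.B Y.B).symm (w, 0) =
          (LinearMap.inl L X.B Y.B).baseChange ℂ w := by
        rw [LinearEquiv.symm_apply_eq]
        induction w with
        | zero => simp
        | add x y hx hy => simp [← hx, ← hy]
        | tmul r x => simp
      rw [← h]
      simp [directSumC]⟩ : Hom _ _)

/-- The inclusion of the second summand. -/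
def inr (X Y : DRB K L) : Y ⟶ directSum X Y :=
  (⟨LinearMap.inr K X.dR Y.dR, LinearMap.inr L X.B Y.B, fun z ↦ by
    induction z with
    | zero => simp
    | add x y hx hy => simp only [map_add, hx, hy]
    | tmul r x =>
      have h (w : ℂ ⊗[L] Y.B) : (TensorProduct.prodRight L ℂ ℂ X.B Y.B).symm (0, w) =
          (LinearMap.inr L X.B Y.B).baseChange ℂ w := by
        rw [LinearEquiv.symm_apply_eq]
        induction w with
        | zero => simp
        | add x y hx hy => simp [← hx, ← hy]
        | tmul r x => simp
      rw [← h]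
      simp [directSumC]⟩ : Hom _ _)

/-- The complexified contraction is the pairing through which the dual comparison was defined; so
the contragredient comparison makes evaluation a morphism. -/
lemma rid_contractLeft_bcMul {k V : Type*} [Field k] [Algebra k ℂ] [AddCommGroup V] [Module k V]
    [Module.Finite k V] (φ : ℂ ⊗[k] Module.Dual k V) (v : ℂ ⊗[k] V) :
    AlgebraTensorModule.rid k ℂ ℂ
      ((contractLeft k V).baseChange ℂ (bcMul k ℂ (Module.Dual k V) V φ v)) =
      (TensorProduct.isBaseChange k V ℂ).toDualBaseChange φ v := by
  induction φ with
  | zero => simp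
  | add x y hx hy => simp only [map_add, LinearMap.add_apply, hx, hy]
  | tmul r l =>
    induction v with
    | zero => simp
    | add x y hx hy => simp only [map_add, hx, hy]
    | tmul s v =>
      rw [bcMul_tmul]
      have h1 : (TensorProduct.isBaseChange k V ℂ).toDualBaseChange (r ⊗ₜ[k] l) (1 ⊗ₜ[k] v) =
          r * algebraMap k ℂ (l v) :=
        (TensorProduct.isBaseChange k V ℂ).toDualBaseChange_tmul r l v
      have h2 : s ⊗ₜ[k] v = s • ((1 : ℂ) ⊗ₜ[k] v) := by rw [smul_tmul', smul_eq_mul, mul_one]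
      rw [h2, map_smul, h1]
      simp only [LinearMap.baseChange_tmul, contractLeft_apply, AlgebraTensorModule.rid_tmul,
        smul_eq_mul]
      rw [Algebra.smul_def]
      ring

/-- The evaluation morphism of the dual. -/
def ev (X : DRB K L) : dual X ⊗ X ⟶ 𝟙_ (DRB K L) :=
  (⟨contractLeft K X.dR, contractLeft L X.B, fun z ↦ by
    induction z using bcMul_induction with
    | hadd x y hx hy => simp only [map_add, hx, hy]
    | h0 => simp
    | hmul φ v =>
      change unitC K L _ = (contractLeft L X.B).baseChange ℂ
        (tensorC (dual X) X (bcMul K ℂ _ _ φ v))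
      rw [tensorC_bcMul]
      apply (AlgebraTensorModule.rid L ℂ ℂ).injective
      rw [rid_contractLeft_bcMul]
      refine Eq.trans ?_ (dualC_pairing X φ v).symm
      rw [← rid_contractLeft_bcMul]
      simp [unitC]⟩ : Hom _ _)

/-- Classes of objects that contain the unit and are stable under the operations of tensor
categories. -/
structure IsTannakian (P : ObjectProperty (DRB K L)) : Prop where
  one : P (𝟙_ (DRB K L))
  tensor {X Y} : P X → P Y → P (X ⊗ Y)
  dual {X} : P X → P (dual X)
  directSum {X Y} : P X → P Y → P (directSum X Y)
  subquotient {X Y} : IsSubquotient X Y → P Y → P X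

lemma isTannakian_top : IsTannakian (⊤ : ObjectProperty (DRB K L)) :=
  ⟨trivial, fun _ _ ↦ trivial, fun _ ↦ trivial, fun _ _ ↦ trivial, fun _ _ ↦ trivial⟩

lemma isTannakian_generated (M : DRB K L) : IsTannakian (generated M) :=
  ⟨.one, .tensor, .dual, .directSum, .subquotient⟩

/-- The properties of the two fibre functors that express tensor products, duals and direct sums
through the underlying vector spaces. -/
structure IsFibre {k : Type} [Field k] (F : DRB K L ⥤ ModuleCat.{0} k) [F.LaxMonoidal] :
    Prop where
  sum (X Y : DRB K L) (l : Module.Dual k (F.obj X)) (m : Module.Dual k (F.obj Y)) :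
    ∃ n : Module.Dual k (F.obj (DRB.directSum X Y)),
      n ∘ₗ (F.map (inl X Y)).hom = l ∧ n ∘ₗ (F.map (inr X Y)).hom = m
  prod (X Y : DRB K L) (l : Module.Dual k (F.obj X)) (m : Module.Dual k (F.obj Y)) :
    ∃ n : Module.Dual k (F.obj (X ⊗ Y)), ∀ x y, n ((μ F X Y).hom (x ⊗ₜ[k] y)) = l x * m y
  one : ∃ n : Module.Dual k (F.obj (𝟙_ (DRB K L))), n ((ε F).hom (1 : k)) = 1
  vec (X : DRB K L) (φ : Module.Dual k (F.obj X)) : ∃ x' : F.obj (DRB.dual X),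
    ∀ x, (F.map (ev X)).hom ((μ F (DRB.dual X) X).hom (x' ⊗ₜ[k] x)) = (ε F).hom (φ x)
  form (X : DRB K L) (y : F.obj X) : ∃ l : Module.Dual k (F.obj (DRB.dual X)),
    ∀ y', (F.map (ev X)).hom ((μ F (DRB.dual X) X).hom (y' ⊗ₜ[k] y)) = (ε F).hom (l y')

lemma isFibre_omegaDR : IsFibre (omegaDR K L) where
  sum X Y l m := ⟨LinearMap.coprod (M := X.dR) (M₂ := Y.dR) l m,
    LinearMap.coprod_inl (show X.dR →ₗ[K] K from l) (show Y.dR →ₗ[K] K from m),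
    LinearMap.coprod_inr (show X.dR →ₗ[K] K from l) (show Y.dR →ₗ[K] K from m)⟩
  prod X Y l m := ⟨(LinearMap.mul' K K) ∘ₗ TensorProduct.map (M := X.dR) (N := Y.dR) l m,
    fun _ _ ↦ rfl⟩
  one := ⟨LinearMap.id (M := K), rfl⟩
  vec X φ := ⟨(φ : Module.Dual K X.dR), fun _ ↦ rfl⟩
  form X y := ⟨Module.Dual.eval K X.dR y, fun _ ↦ rfl⟩

lemma isFibre_omegaB : IsFibre (omegaB K L) where
  sum X Y l m := ⟨LinearMap.coprod (M := X.B) (M₂ := Y.B) l m,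
    LinearMap.coprod_inl (show X.B →ₗ[L] L from l) (show Y.B →ₗ[L] L from m),
    LinearMap.coprod_inr (show X.B →ₗ[L] L from l) (show Y.B →ₗ[L] L from m)⟩
  prod X Y l m := ⟨(LinearMap.mul' L L) ∘ₗ TensorProduct.map (M := X.B) (N := Y.B) l m,
    fun _ _ ↦ rfl⟩
  one := ⟨LinearMap.id (M := L), rfl⟩
  vec X φ := ⟨(φ : Module.Dual L X.B), fun _ ↦ rfl⟩
  form X y := ⟨Module.Dual.eval L X.B y, fun _ ↦ rfl⟩

/-- An algebra generated by the matrix coefficients of an isomorphism of tensor functors and of its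
inverse consists of matrix coefficients. -/
lemma exists_eq_coeff {P : ObjectProperty (DRB K L)} (hP : IsTannakian P) {k₁ k₂ : Type}
    [Field k₁] [Field k₂] {F : DRB K L ⥤ ModuleCat.{0} k₁} {G : DRB K L ⥤ ModuleCat.{0} k₂}
    [F.LaxMonoidal] [G.LaxMonoidal] (hF : IsFibre F) (hG : IsFibre G)
    {R : Type*} [CommRing R] [Algebra k₁ R] [Algebra k₂ R] (g : MixedIso P F G R)
    (hg : Algebra.adjoin k₁ ({r | ∃ X hX l x, r = g.coeff X hX l x} ∪
      {r | ∃ X hX φ y, r = evalDual R φ ((g.app X hX).symm (1 ⊗ₜ y))}) = ⊤) (r : R) :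
    ∃ X hX l x, r = g.coeff X hX l x := by
  obtain ⟨η, hη⟩ := hG.one
  have hr : r ∈ (⊤ : Subalgebra k₁ R) := trivial
  rw [← hg] at hr
  induction hr using Algebra.adjoin_induction with
  | mem r hr =>
    obtain hr | ⟨X, hX, φ, y, rfl⟩ := hr
    · exact hr
    -- A coefficient of the inverse on `X` is a coefficient on the dual of `X`: `φ` becomes a vector
    -- there and `y` a form.
    · obtain ⟨x', hx'⟩ := hF.vec X φ
      obtain ⟨l, hl⟩ := hG.form X y
      exact ⟨_, hP.dual hX, l, x', g.evalDual_symm_app hP.one hX (hP.dual hX)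
        (hP.tensor (hP.dual hX) hX) (ev X) hx' hl hη⟩
  | algebraMap t =>
    refine ⟨_, hP.one, η, t • (ε F).hom (1 : k₁), ?_⟩
    rw [map_smul, g.coeff_unit hP.one hη, Algebra.smul_def, mul_one]
  | add r s _ _ hr hs =>
    obtain ⟨X, hX, l, x, rfl⟩ := hr
    obtain ⟨Y, hY, m, y, rfl⟩ := hs
    -- The sum is the coefficient of `(l, m)` at `(x, y)` on the direct sum.
    obtain ⟨n, rfl, rfl⟩ := hG.sum X Y l m
    refine ⟨_, hP.directSum hX hY, n, (F.map (inl X Y)).hom x + (F.map (inr X Y)).hom y, ?_⟩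
    rw [map_add, g.coeff_map hX, g.coeff_map hY]
  | mul r s _ _ hr hs =>
    obtain ⟨X, hX, l, x, rfl⟩ := hr
    obtain ⟨Y, hY, m, y, rfl⟩ := hs
    obtain ⟨n, hn⟩ := hG.prod X Y l m
    exact ⟨_, hP.tensor hX hY, n, (μ F X Y).hom (x ⊗ₜ[k₁] y),
      (g.coeff_tensor hX hY (hP.tensor hX hY) hn x y).symm⟩

end DRB

lemma baseChange_subtype_injective {k R V : Type*} [Field k] [CommRing R] [Algebra k R]
    [AddCommGroup V] [Module k V] (Y : Submodule k V) :
    Function.Injective (Y.toBaseChange R) := by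
  have h : (Y.baseChange R).subtype ∘ₗ Y.toBaseChange R = Y.subtype.baseChange R := by
    ext; simp
  refine Function.Injective.of_comp (f := (Y.baseChange R).subtype) ?_
  rw [← LinearMap.coe_comp, h]
  exact Module.Flat.lTensor_preserves_injective_linearMap (M := R) Y.subtype
    Y.injective_subtype

/-- The base change of a subspace, as a subspace of the base change. -/
def submoduleBaseChangeEquiv {k : Type*} (R : Type*) {V : Type*} [Field k] [CommRing R]
    [Algebra k R] [AddCommGroup V] [Module k V] (Y : Submodule k V) :
    R ⊗[k] Y ≃ₗ[R] Y.baseChange R :=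
  LinearEquiv.ofBijective (Y.toBaseChange R)
    ⟨baseChange_subtype_injective Y, Y.toBaseChange_surjective R⟩

lemma coe_submoduleBaseChangeEquiv {k : Type*} (R : Type*) {V : Type*} [Field k] [CommRing R]
    [Algebra k R] [AddCommGroup V] [Module k V] (Y : Submodule k V) (z : R ⊗[k] Y) :
    (submoduleBaseChangeEquiv R Y z : R ⊗[k] V) = Y.subtype.baseChange R z := by
  have h : (Y.baseChange R).subtype ∘ₗ Y.toBaseChange R = Y.subtype.baseChange R := by
    ext; simp
  exact LinearMap.congr_fun h z

/-! ### Subobjects, morphisms to the unit object and constancy of idempotents -/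

namespace DRB

variable {K L : Type} [Field K] [Field L] [Algebra K ℂ] [Algebra L ℂ]

section Sub

variable (X : DRB K L) (Y : Submodule K X.dR) (Y' : Submodule L X.B)
  (h : ∀ z, X.c z ∈ Y'.baseChange ℂ ↔ z ∈ Y.baseChange ℂ)

/-- The comparison isomorphism of a subobject. -/
def subC : ℂ ⊗[K] Y ≃ₗ[ℂ] ℂ ⊗[L] Y' :=
  submoduleBaseChangeEquiv ℂ Y ≪≫ₗ
    X.c.ofSubmodules (Y.baseChange ℂ) (Y'.baseChange ℂ) (by
      ext w
      obtain ⟨z, rfl⟩ := X.c.surjective w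
      rw [h]
      exact ⟨fun ⟨v, hv, e⟩ ↦ X.c.injective e ▸ hv, fun hz ↦ ⟨z, hz, rfl⟩⟩) ≪≫ₗ
    (submoduleBaseChangeEquiv ℂ Y').symm

lemma subC_spec (z : ℂ ⊗[K] Y) :
    Y'.subtype.baseChange ℂ (subC X Y Y' h z) = X.c (Y.subtype.baseChange ℂ z) := by
  rw [← coe_submoduleBaseChangeEquiv, ← coe_submoduleBaseChangeEquiv]
  simp [subC]

/-- The subobject defined by compatible subspaces. -/
abbrev sub : DRB K L := ⟨Y, Y', subC X Y Y' h⟩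

/-- The inclusion of a subobject. -/
def subι : sub X Y Y' h ⟶ X :=
  (⟨Y.subtype, Y'.subtype, fun z ↦ by
    change X.c (Y.subtype.baseChange ℂ z) = Y'.subtype.baseChange ℂ (subC X Y Y' h z)
    rw [subC_spec]⟩ : Hom _ _)

lemma isSubquotient_sub : IsSubquotient (sub X Y Y' h) X := by
  refine ⟨_, subι X Y Y' h, 𝟙 _, ⟨fun a b hab ↦ ?_⟩, inferInstance⟩
  refine hom_ext (LinearMap.ext fun v ↦ ?_) (LinearMap.ext fun v ↦ ?_)
  · exact Y.injective_subtype (LinearMap.congr_fun (congrArg Hom.dR hab) v)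
  · exact Y'.injective_subtype (LinearMap.congr_fun (congrArg Hom.B hab) v)

/-- A morphism from a subobject to the unit object. -/
def subToUnit (l : Module.Dual L X.B) (t : Y →ₗ[K] K)
    (ht : ∀ y : Y, evalDual ℂ l (X.c (1 ⊗ₜ (y : X.dR))) = algebraMap K ℂ (t y)) :
    sub X Y Y' h ⟶ 𝟙_ (DRB K L) :=
  (⟨t, l ∘ₗ Y'.subtype, fun z ↦ by
    change unitC K L (t.baseChange ℂ z) =
      (l ∘ₗ Y'.subtype).baseChange ℂ (subC X Y Y' h z)
    apply (AlgebraTensorModule.rid L ℂ ℂ).injective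
    have h1 : AlgebraTensorModule.rid L ℂ ℂ
        ((l ∘ₗ Y'.subtype).baseChange ℂ (subC X Y Y' h z)) =
        evalDual ℂ l (Y'.subtype.baseChange ℂ (subC X Y Y' h z)) := (evalDual_map _ _ _).symm
    rw [h1, subC_spec]
    clear h1
    induction z with
    | zero => simp
    | add x y hx hy => simp only [map_add, hx, hy]
    | tmul r y =>
      have h2 : r ⊗ₜ[K] (y : X.dR) = r • ((1 : ℂ) ⊗ₜ[K] (y : X.dR)) := by
        rw [smul_tmul', smul_eq_mul, mul_one]
      rw [LinearMap.baseChange_tmul, LinearMap.baseChange_tmul, Submodule.subtype_apply, h2,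
        map_smul, map_smul, ht, unitC_tmul, AlgebraTensorModule.rid_tmul, one_smul,
        Algebra.smul_def, smul_eq_mul, mul_comm]⟩ : Hom _ _)

end Sub

/-- An idempotent complex number is 0 or 1. This is where complex periods are forced into `K`. -/
lemma map_idemSpan_mem_range {A : Type*} [CommRing A] [Algebra K A] (p : A →ₐ[K] ℂ) {a : A}
    (ha : a ∈ idemSpan K A) : p a ∈ LinearMap.range (Algebra.linearMap K ℂ) := by
  induction ha using Submodule.span_induction with
  | mem x hx =>
    obtain h | h := IsIdempotentElem.iff_eq_zero_or_one.1 (IsIdempotentElem.map hx p)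
    · rw [h]; exact zero_mem _
    · rw [h]; exact ⟨1, by simp⟩
  | zero => rw [map_zero]; exact zero_mem _
  | add x y _ _ hx hy => rw [map_add]; exact add_mem hx hy
  | smul r x _ hx => rw [map_smul]; exact Submodule.smul_mem _ _ hx

/-- Vectors on which matrix coefficients are idempotent lie in a subobject on which the linear form
defining the coefficients is a morphism to the unit object. -/
lemma exists_sub_hom_unit [Algebra L K] [IsScalarTower L K ℂ] [IsAlgClosed K] [IsGalois L K]
    {A A' : Type*} [CommRing A] [Algebra K A] [CommRing A'] [Algebra L A'] (X : DRB K L)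
    (f : X.dR →ₗ[K] A) (f' : X.B →ₗ[L] A') (l : Module.Dual L X.B)
    (Φ : ℂ ⊗[K] A →ₐ[ℂ] ℂ ⊗[L] A') (Ψ : ℂ ⊗[L] A' →ₐ[ℂ] ℂ ⊗[K] A)
    (hΦ : ∀ z, Φ (f.baseChange ℂ z) = f'.baseChange ℂ (X.c z))
    (hΨ : ∀ z, Ψ (f'.baseChange ℂ (X.c z)) = f.baseChange ℂ z)
    (p : A →ₐ[K] ℂ) (hp : ∀ x, p (f x) = evalDual ℂ l (X.c (1 ⊗ₜ x))) :
    ∃ (Y : DRB K L) (i : Y ⟶ X) (q : Y ⟶ 𝟙_ (DRB K L)), IsSubquotient Y X ∧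
      (∀ w, q.B w = l (i.B w)) ∧ (∀ x, IsIdempotentElem (f x) → ∃ y, i.dR y = x) ∧
      ∀ x, IsIdempotentElem (f' x) → ∃ y, i.B y = x := by
  obtain ⟨Y, Y', h, hY, hY'⟩ := exists_compatible_submodules X.c f f' Φ Ψ hΦ hΨ
  -- The values of `p` on the coefficients of `Y` are the periods `l (c y)`. They lie in the image
  -- of `K`, and `t` is the resulting form on the de Rham side.
  let t : Y →ₗ[K] K :=
    (LinearEquiv.ofInjective (Algebra.linearMap K ℂ) (algebraMap K ℂ).injective).symm ∘ₗ
      ((p.toLinearMap ∘ₗ f) ∘ₗ Y.subtype).codRestrict (LinearMap.range (Algebra.linearMap K ℂ))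
        fun y ↦ map_idemSpan_mem_range p ((hY y).1 y.2)
  have ht (y : Y) : algebraMap K ℂ (t y) = p (f y) :=
    congrArg Subtype.val (LinearEquiv.apply_symm_apply
      (LinearEquiv.ofInjective (Algebra.linearMap K ℂ) (algebraMap K ℂ).injective) _)
  refine ⟨sub X Y Y' h, subι X Y Y' h, subToUnit X Y Y' h l t fun y ↦ by rw [ht, hp],
    isSubquotient_sub X Y Y' h, fun w ↦ rfl,
    fun x hx ↦ ⟨⟨x, (hY x).2 (Submodule.subset_span hx)⟩, rfl⟩,
    fun x hx ↦ ⟨⟨x, hY' x hx⟩, rfl⟩⟩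

lemma eq_zero_or_eq_one_of_eq_algebraMap {k A : Type*} [Field k] [CommRing A] [Nontrivial A]
    [Algebra k A] {e : A} (he : IsIdempotentElem e) {t : k} (h : e = algebraMap k A t) :
    e = 0 ∨ e = 1 := by
  subst h
  have : IsIdempotentElem t := (algebraMap k A).injective (by rw [map_mul]; exact he)
  obtain rfl | rfl := IsIdempotentElem.iff_eq_zero_or_one.1 this
  · left; simp
  · right; simp

variable {P : ObjectProperty (DRB K L)} {R : Type*} [CommRing R] [Algebra L R]

/-- The matrix coefficients of an isomorphism from de Rham to Betti realizations. -/
def coeffDR [Algebra K R] (u : MixedIso P (omegaDR K L) (omegaB K L) R) (X : DRB K L) (hX : P X)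
    (l : Module.Dual L X.B) : X.dR →ₗ[K] R :=
  u.coeff X hX l

/-- The matrix coefficients of an automorphism of Betti realizations. -/
def coeffB (g : MixedIso P (omegaB K L) (omegaB K L) R) (X : DRB K L) (hX : P X)
    (l : Module.Dual L X.B) : X.B →ₗ[L] R :=
  g.coeff X hX l

/-- The universal isomorphisms for the torsor of periods and for the de Rham--Betti group have
connected parameter spaces. -/
theorem connectedSpace_of_universal [Algebra L K] [IsScalarTower L K ℂ] [IsAlgClosed K]
    [IsGalois L K] (hP : IsTannakian P)
    {A A' : Type*} [CommRing A] [Algebra K A] [Algebra L A] [CommRing A'] [Algebra L A']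
    (u : MixedIso P (omegaDR K L) (omegaB K L) A) (g : MixedIso P (omegaB K L) (omegaB K L) A')
    (hu : Algebra.adjoin K ({r | ∃ X hX l x, r = u.coeff X hX l x} ∪
      {r | ∃ X hX φ y, r = evalDual A φ ((u.app X hX).symm (1 ⊗ₜ y))}) = ⊤)
    (hg : Algebra.adjoin L ({r | ∃ X hX l x, r = g.coeff X hX l x} ∪
      {r | ∃ X hX φ y, r = evalDual A' φ ((g.app X hX).symm (1 ⊗ₜ y))}) = ⊤)
    (Φ : ℂ ⊗[K] A →ₐ[ℂ] ℂ ⊗[L] A') (Ψ : ℂ ⊗[L] A' →ₐ[ℂ] ℂ ⊗[K] A)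
    (hΦ : ∀ (X : DRB K L) (hX : P X) (l : Module.Dual L X.B) (z : ℂ ⊗[K] X.dR),
      Φ ((coeffDR u X hX l).baseChange ℂ z) =
        (coeffB g X hX l).baseChange ℂ (X.c z))
    (hΨ : ∀ (X : DRB K L) (hX : P X) (l : Module.Dual L X.B) (z : ℂ ⊗[K] X.dR),
      Ψ ((coeffB g X hX l).baseChange ℂ (X.c z)) =
        (coeffDR u X hX l).baseChange ℂ z)
    (p : A →ₐ[K] ℂ)
    (hp : ∀ (X : DRB K L) (hX : P X) (l : Module.Dual L X.B) (x : X.dR),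
      p (u.coeff X hX l x) = evalDual ℂ l (X.c (1 ⊗ₜ x)))
    (p' : A' →ₐ[L] L) : ConnectedSpace (PrimeSpectrum A') ∧ ConnectedSpace (PrimeSpectrum A) := by
  -- The points `p` and `p'` make the rings nonzero, so the spectra are non-empty.
  have : Nontrivial A := p.toRingHom.domain_nontrivial
  have : Nontrivial A' := p'.toRingHom.domain_nontrivial
  obtain ⟨η, hη⟩ := (isFibre_omegaB (K := K) (L := L)).one
  constructor
  · refine connectedSpace_primeSpectrum fun e he ↦ ?_
    obtain ⟨X, hX, l, x, rfl⟩ := exists_eq_coeff hP isFibre_omegaB isFibre_omegaB g hg e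
    obtain ⟨Y, i, q, hY, hq, -, hi⟩ := exists_sub_hom_unit X (coeffDR u X hX l) (coeffB g X hX l) l
      Φ Ψ (hΦ X hX l) (hΨ X hX l) p (hp X hX l)
    obtain ⟨y, rfl⟩ := hi x he
    exact eq_zero_or_eq_one_of_eq_algebraMap he (g.coeff_eq_algebraMap hP.one hX
      (hP.subquotient hY hX) i q (t := l (i.B y)) (hq y) hq hη)
  · refine connectedSpace_primeSpectrum fun e he ↦ ?_
    obtain ⟨X, hX, l, x, rfl⟩ := exists_eq_coeff hP isFibre_omegaDR isFibre_omegaB u hu e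
    obtain ⟨Y, i, q, hY, hq, hi, -⟩ := exists_sub_hom_unit X (coeffDR u X hX l) (coeffB g X hX l) l
      Φ Ψ (hΦ X hX l) (hΨ X hX l) p (hp X hX l)
    obtain ⟨y, rfl⟩ := hi x he
    exact eq_zero_or_eq_one_of_eq_algebraMap he (u.coeff_eq_algebraMap hP.one hX
      (hP.subquotient hY hX) i q (t := q.dR y) rfl hq hη)

end DRB

/-! ### Tensor isomorphisms on full subcategories and extension of scalars of a functor -/

namespace MixedIso

section TensorIso

variable {E : Type} [Field E] {D : Type u} [Category.{v} D] [MonoidalCategory D]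
  {F G : D ⥤ ModuleCat.{0} E} [F.LaxMonoidal] [G.LaxMonoidal]
  {R : Type w} [CommRing R] [Algebra E R]

/-- A tensor isomorphism, viewed on the class of all objects. -/
def ofTensorIso (g : TensorIso F G R) : MixedIso (⊤ : ObjectProperty D) F G R where
  app X _ := g.app X
  naturality _ _ f a := g.naturality f a
  unit _ := g.unit
  tensor X Y _ _ _ a b := g.tensor X Y a b

/-- The tensor isomorphism of an isomorphism on the class of all objects. -/
def toTensorIso (g : MixedIso (⊤ : ObjectProperty D) F G R) : TensorIso F G R where
  app X := g.app X trivial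
  naturality f a := g.naturality trivial trivial f a
  unit := g.unit trivial
  tensor X Y a b := g.tensor X Y trivial trivial trivial a b

variable {P : ObjectProperty D} [P.IsMonoidal]

/-- The tensor structure of the inclusion consists of identities, so composing with it changes
nothing in that of `F`. -/
lemma tensorMul_ι (X Y : P.FullSubcategory) (a : R ⊗[E] F.obj X.obj) (b : R ⊗[E] F.obj Y.obj) :
    tensorMul (P.ι ⋙ F) R X Y a b = tensorMul F R X.obj Y.obj a b := by
  have h : μ (P.ι ⋙ F) X Y = μ F X.obj Y.obj := by
    rw [Functor.LaxMonoidal.comp_μ, ObjectProperty.ι_μ]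
    exact (congrArg _ (F.map_id _)).trans (Category.comp_id _)
  change LinearMap.baseChange R (μ (P.ι ⋙ F) X Y).hom _ = _
  rw [h]
  rfl

lemma ε_ι : ε (P.ι ⋙ F) = ε F := by
  rw [Functor.LaxMonoidal.comp_ε, ObjectProperty.ι_ε]
  exact (congrArg _ (F.map_id _)).trans (Category.comp_id _)

/-- A tensor isomorphism on a full subcategory, viewed on the corresponding class of objects. -/
def ofTensorIsoFull (g : TensorIso (P.ι ⋙ F) (P.ι ⋙ G) R) : MixedIso P F G R where
  app X hX := g.app ⟨X, hX⟩
  naturality {X Y} hX hY f a := g.naturality (X := ⟨X, hX⟩) (Y := ⟨Y, hY⟩)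
    (ObjectProperty.homMk f) a
  unit _ := by
    have := g.unit
    rw [ε_ι, ε_ι] at this
    exact this
  tensor X Y hX hY h a b := by
    let X' : P.FullSubcategory := ⟨X, hX⟩
    let Y' : P.FullSubcategory := ⟨Y, hY⟩
    have h1 := tensorMul_ι (F := F) X' Y' a b
    have h2 := tensorMul_ι (F := G) X' Y' (g.app X' a) (g.app Y' b)
    exact ((congrArg (g.app (X' ⊗ Y')) h1).symm.trans (g.tensor X' Y' a b)).trans h2

/-- The tensor isomorphism on a full subcategory of an isomorphism on the corresponding class of
objects. -/
def toTensorIsoFull (g : MixedIso P F G R) : TensorIso (P.ι ⋙ F) (P.ι ⋙ G) R where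
  app X := g.app X.obj X.property
  naturality {X Y} f a := g.naturality X.property Y.property f.hom a
  unit := by
    rw [ε_ι, ε_ι]
    exact g.unit _
  tensor X Y a b := by
    have h1 := tensorMul_ι (F := F) X Y a b
    have h2 := tensorMul_ι (F := G) X Y (g.app X.obj X.property a) (g.app Y.obj Y.property b)
    exact ((congrArg (g.app (X ⊗ Y).obj (X ⊗ Y).property) h1).trans
      (g.tensor X.obj Y.obj X.property Y.property (X ⊗ Y).property a b)).trans h2.symm

end TensorIso

section ExtendScalars

variable {k₁ k₂ : Type} [Field k₁] [Field k₂] {D : Type u} [Category.{v} D] [MonoidalCategory D]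

/-- The canonical isomorphism from a tensor functor to its extension of scalars. -/
def toExtendScalars (P : ObjectProperty D) (G : D ⥤ ModuleCat.{0} k₂) [G.LaxMonoidal]
    (f : k₂ →+* k₁) (R : Type w) [CommRing R] [Algebra k₁ R] [Algebra k₂ R]
    (h : ∀ t, algebraMap k₂ R t = algebraMap k₁ R (f t)) :
    MixedIso P G (G ⋙ ModuleCat.extendScalars.{0, 0, 0} f) R :=
  letI := f.toAlgebra
  haveI : IsScalarTower k₂ k₁ R := IsScalarTower.of_algebraMap_eq h
  ofVectors (fun X _ ↦ (AlgebraTensorModule.cancelBaseChange k₂ k₁ R R (G.obj X)).symm)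
    (fun hX hY f x ↦ rfl)
    (fun _ ↦ rfl)
    (fun X Y _ _ _ x y ↦ by
      have h1 : tensorMul (G ⋙ ModuleCat.extendScalars.{0, 0, 0} f) R X Y
          ((1 : R) ⊗ₜ[k₁] ((1 : k₁) ⊗ₜ[k₂] x)) ((1 : R) ⊗ₜ[k₁] ((1 : k₁) ⊗ₜ[k₂] y)) = _ :=
        tensorMul_tmul _ R X Y 1 1 _ _
      refine Eq.trans ?_ h1.symm
      -- The tensor structure of `extendScalars` is the inverse of `distribBaseChange`; its value on
      -- vectors from the smaller field is read off in the other direction.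
      have h2 : (AlgebraTensorModule.distribBaseChange k₂ k₁ (G.obj X) (G.obj Y)).symm
          (((1 : k₁) ⊗ₜ[k₂] x) ⊗ₜ[k₁] ((1 : k₁) ⊗ₜ[k₂] y)) = 1 ⊗ₜ (x ⊗ₜ y) := by
        rw [LinearEquiv.symm_apply_eq, AlgebraTensorModule.distribBaseChange_tmul]
      have h3 : (μ (G ⋙ ModuleCat.extendScalars.{0, 0, 0} f) X Y).hom
          (((1 : k₁) ⊗ₜ[k₂] x) ⊗ₜ[k₁] ((1 : k₁) ⊗ₜ[k₂] y)) =
          (μ G X Y).hom.baseChange k₁ (1 ⊗ₜ (x ⊗ₜ y)) :=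
        congrArg ((μ G X Y).hom.baseChange k₁) h2
      rw [one_mul]
      exact congrArg (fun z ↦ (1 : R) ⊗ₜ[k₁] z) h3.symm)

end ExtendScalars

end MixedIso

/-! ### Matrix coefficients generate the coordinate ring -/

namespace TensorIso

lemma evalDual_coord {E : Type} [Field E] {R V : Type*} [CommRing R] [Algebra E R]
    [AddCommGroup V] [Module E V] [Module.Finite E V] (i) (z : R ⊗[E] V) :
    evalDual R ((Module.finBasis E V).coord i) z = (bas E R V).repr z i := by
  induction z with
  | zero => simp
  | add x y hx hy => simp only [map_add, Finsupp.add_apply, hx, hy]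
  | tmul r v => simp [Module.Basis.baseChange_repr_tmul]

lemma evalDual_lin {E : Type} [Field E] {R V W : Type*} [CommRing R] [Algebra E R]
    [AddCommGroup V] [Module E V] [Module.Finite E V] [AddCommGroup W] [Module E W]
    [Module.Finite E W]
    (m : Matrix (Fin (Module.finrank E W)) (Fin (Module.finrank E V)) R) (i j) :
    evalDual R ((Module.finBasis E W).coord i) (lin V W m (1 ⊗ₜ Module.finBasis E V j)) =
      m i j := by
  have h : (1 : R) ⊗ₜ[E] Module.finBasis E V j = bas E R V j := by simp
  rw [evalDual_coord, h, lin, ← LinearMap.toMatrix_apply, LinearMap.toMatrix_toLin]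

variable {E : Type} [Field E] {C : Type u} [Category.{v} C] [MonoidalCategory C]
  (F G : C ⥤ ModuleCat.{0} E) [∀ X, Module.Finite E (F.obj X)]
  [∀ X, Module.Finite E (G.obj X)] [F.LaxMonoidal] [G.LaxMonoidal]

/-- The coordinate ring is a quotient of a polynomial ring whose variables are the matrix entries of
the universal isomorphism and of its inverse, and matrix entries are coefficients for basis vectors
and dual basis forms. -/
lemma adjoin_generic : Algebra.adjoin E
    ({r | ∃ X l x, r = evalDual _ l ((generic F G).app X (1 ⊗ₜ x))} ∪
      {r | ∃ X φ y, r = evalDual _ φ (((generic F G).app X).symm (1 ⊗ₜ y))}) = ⊤ := by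
  rw [eq_top_iff]
  rintro r -
  obtain ⟨p, rfl⟩ := Ideal.Quotient.mk_surjective r
  induction p using MvPolynomial.induction_on with
  | C a => exact Subalgebra.algebraMap_mem _ a
  | add p q hp hq => rw [map_add]; exact add_mem hp hq
  | mul_X p s hp =>
    rw [map_mul]
    refine mul_mem hp (Algebra.subset_adjoin ?_)
    change coordFn F G s ∈ _
    obtain ⟨X, ⟨i, j⟩ | ⟨i, j⟩⟩ := s
    · exact Or.inl ⟨X, _, _, (evalDual_lin (Matrix.of fun i j ↦ coordFn F G ⟨X, .inl (i, j)⟩) i j).symm⟩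
    · exact Or.inr ⟨X, _, _, (evalDual_lin (Matrix.of fun i j ↦ coordFn F G ⟨X, .inr (i, j)⟩) i j).symm⟩

variable {F G}

lemma exists_algHom_evalDual {R : Type w} [CommRing R] [Algebra E R] (g : TensorIso F G R) :
    ∃ φ : CoordRing F G →ₐ[E] R, ∀ X l x,
      φ (evalDual _ l ((generic F G).app X (1 ⊗ₜ x))) = evalDual R l (g.app X (1 ⊗ₜ x)) := by
  obtain ⟨φ, hφ, -⟩ := existsUnique_map_generic g
  refine ⟨φ, fun X l x ↦ ?_⟩
  rw [← evalDual_bc, ← hφ]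
  simp

end TensorIso

/-! ### Universal isomorphisms: generation and lifting -/

namespace MixedIso

variable {k₁ k₂ : Type} [Field k₁] [Field k₂] {D : Type u} [Category.{v} D]
    [MonoidalCategory D] {P : ObjectProperty D} {F : D ⥤ ModuleCat.{0} k₁}
    {G : D ⥤ ModuleCat.{0} k₂} [F.LaxMonoidal] [G.LaxMonoidal]
    {A : Type*} [CommRing A] [Algebra k₁ A] [Algebra k₂ A]
    {R : Type*} [CommRing R] [Algebra k₁ R] [Algebra k₂ R]

/-- The matrix coefficients of an isomorphism and of its inverse generate the algebra. -/
def Generates (u : MixedIso P F G A) : Prop :=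
  Algebra.adjoin k₁ ({r | ∃ X hX l x, r = u.coeff X hX l x} ∪
    {r | ∃ X hX φ y, r = evalDual A φ ((u.app X hX).symm (1 ⊗ₜ y))}) = ⊤

/-- An isomorphism is obtained from another one by a homomorphism of algebras. -/
def LiftsTo (u : MixedIso P F G A) (g : MixedIso P F G R) : Prop :=
  ∃ φ : A →ₐ[k₁] R, ∀ X hX l x, φ (u.coeff X hX l x) = g.coeff X hX l x

section TensorIso

variable {E : Type} [Field E] {F G : D ⥤ ModuleCat.{0} E} [F.LaxMonoidal] [G.LaxMonoidal]
  [∀ X, Module.Finite E (F.obj X)] [∀ X, Module.Finite E (G.obj X)]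
  {R : Type*} [CommRing R] [Algebra E R]

variable (F G) in
/-- The universal tensor isomorphism. -/
def universal : MixedIso (⊤ : ObjectProperty D) F G (TensorIso.CoordRing F G) :=
  ofTensorIso (TensorIso.generic F G)

lemma universal_generates : (universal F G).Generates := by
  rw [Generates, ← TensorIso.adjoin_generic F G]
  congr 1
  ext r
  constructor
  · rintro (⟨X, -, l, x, rfl⟩ | ⟨X, -, l, x, rfl⟩)
    · exact Or.inl ⟨X, l, x, rfl⟩
    · exact Or.inr ⟨X, l, x, rfl⟩
  · rintro (⟨X, l, x, rfl⟩ | ⟨X, l, x, rfl⟩)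
    · exact Or.inl ⟨X, trivial, l, x, rfl⟩
    · exact Or.inr ⟨X, trivial, l, x, rfl⟩

lemma universal_liftsTo (g : MixedIso ⊤ F G R) : (universal F G).LiftsTo g := by
  obtain ⟨φ, hφ⟩ := TensorIso.exists_algHom_evalDual g.toTensorIso
  exact ⟨φ, fun X _ l x ↦ hφ X l x⟩

variable (P) [P.IsMonoidal] [∀ X, Module.Finite E ((P.ι ⋙ F).obj X)]
  [∀ X, Module.Finite E ((P.ι ⋙ G).obj X)]

variable (F G) in
/-- The universal tensor isomorphism on a full subcategory. -/
def universalFull : MixedIso P F G (TensorIso.CoordRing (P.ι ⋙ F) (P.ι ⋙ G)) :=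
  ofTensorIsoFull (TensorIso.generic (P.ι ⋙ F) (P.ι ⋙ G))

lemma universalFull_generates : (universalFull P F G).Generates := by
  rw [Generates, ← TensorIso.adjoin_generic (P.ι ⋙ F) (P.ι ⋙ G)]
  congr 1
  ext r
  constructor
  · rintro (⟨X, hX, l, x, rfl⟩ | ⟨X, hX, l, x, rfl⟩)
    · exact Or.inl ⟨⟨X, hX⟩, l, x, rfl⟩
    · exact Or.inr ⟨⟨X, hX⟩, l, x, rfl⟩
  · rintro (⟨X, l, x, rfl⟩ | ⟨X, l, x, rfl⟩)
    · exact Or.inl ⟨X.obj, X.property, l, x, rfl⟩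
    · exact Or.inr ⟨X.obj, X.property, l, x, rfl⟩

lemma universalFull_liftsTo (g : MixedIso P F G R) : (universalFull P F G).LiftsTo g := by
  obtain ⟨φ, hφ⟩ := TensorIso.exists_algHom_evalDual g.toTensorIsoFull
  exact ⟨φ, fun X hX l x ↦ hφ ⟨X, hX⟩ l x⟩

end TensorIso

section ExtendScalars

variable {f : k₂ →+* k₁} (hA : ∀ t, algebraMap k₂ A t = algebraMap k₁ A (f t))
  (hR : ∀ t, algebraMap k₂ R t = algebraMap k₁ R (f t))

lemma toExtendScalars_app_tmul (X : D) (hX : P X) (r : R) (y : G.obj X) :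
    letI := f.toAlgebra
    (toExtendScalars P G f R hR).app X hX (r ⊗ₜ[k₂] y) = r ⊗ₜ[k₁] ((1 : k₁) ⊗ₜ[k₂] y) := rfl

/-- The extension of scalars of a linear form. -/
def extendDual (f : k₂ →+* k₁) {X : D} (l : Module.Dual k₂ (G.obj X)) :
    Module.Dual k₁ ((G ⋙ ModuleCat.extendScalars.{0, 0, 0} f).obj X) :=
  letI := f.toAlgebra
  evalDual k₁ l

lemma extendDual_tmul {X : D} (l : Module.Dual k₂ (G.obj X)) (t : k₁) (y : G.obj X) :
    letI := f.toAlgebra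
    extendDual f l (t ⊗ₜ[k₂] y) = f (l y) * t :=
  let := f.toAlgebra
  evalDual_tmul l t y

lemma evalDual_toExtendScalars {X : D} (hX : P X) (l : Module.Dual k₂ (G.obj X))
    (z : R ⊗[k₂] G.obj X) :
    evalDual R (extendDual f l) ((toExtendScalars P G f R hR).app X hX z) = evalDual R l z := by
  induction z with
  | zero => simp
  | add x y hx hy => simp only [map_add, hx, hy]
  | tmul r y =>
    rw [toExtendScalars_app_tmul, evalDual_tmul]
    erw [evalDual_tmul, extendDual_tmul]
    rw [mul_one, Algebra.smul_def, Algebra.smul_def, hR]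

lemma extendScalars_coeff (u : MixedIso P F (G ⋙ ModuleCat.extendScalars.{0, 0, 0} f) R) (X : D)
    (hX : P X) (l : Module.Dual k₂ (G.obj X)) (x : F.obj X) :
    (u.trans (toExtendScalars P G f R hR).symm).coeff X hX l x =
      u.coeff X hX (extendDual f l) x := by
  rw [coeff_apply, coeff_apply, ← evalDual_toExtendScalars hR hX]
  congr 1
  exact ((toExtendScalars P G f R hR).app X hX).apply_symm_apply _

/-- Over a `k₁`-algebra, isomorphisms to `G` and to its extension of scalars are the same thing, so
universality passes from one target to the other. -/
lemma LiftsTo.extendScalars {u : MixedIso P F (G ⋙ ModuleCat.extendScalars.{0, 0, 0} f) A}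
    (g : MixedIso P F G R) (h : u.LiftsTo (g.trans (toExtendScalars P G f R hR))) :
    (u.trans (toExtendScalars P G f A hA).symm).LiftsTo g := by
  obtain ⟨φ, hφ⟩ := h
  refine ⟨φ, fun X hX l x ↦ ?_⟩
  rw [extendScalars_coeff, hφ, coeff_apply, coeff_apply]
  exact evalDual_toExtendScalars hR hX l _

lemma dual_baseChange_eq_sum {k K W ι : Type*} [CommRing k] [CommRing K] [Algebra k K]
    [AddCommGroup W] [Module k W] [Fintype ι] (b : Module.Basis ι k W)
    (l : Module.Dual K (K ⊗[k] W)) :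
    l = ∑ i, l (1 ⊗ₜ b i) • evalDual K (b.coord i) := by
  classical
  refine (b.baseChange K).ext fun j ↦ ?_
  simp [Module.Basis.baseChange_apply, Finsupp.single_apply]

lemma dual_extendScalars_eq_sum {X : D} [Module.Finite k₂ (G.obj X)]
    (l : Module.Dual k₁ ((G ⋙ ModuleCat.extendScalars.{0, 0, 0} f).obj X)) :
    ∃ t : Fin (Module.finrank k₂ (G.obj X)) → k₁,
      l = ∑ i, t i • extendDual f ((Module.finBasis k₂ (G.obj X)).coord i) :=
  let := f.toAlgebra
  ⟨_, dual_baseChange_eq_sum (K := k₁) (Module.finBasis k₂ (G.obj X)) l⟩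

lemma evalDual_sum_smul {k S W ι : Type*} [CommRing k] [CommRing S] [Algebra k S] [AddCommGroup W]
    [Module k W] [Fintype ι] (t : ι → k) (l : ι → Module.Dual k W) (z : S ⊗[k] W) :
    evalDual S (∑ i, t i • l i) z = ∑ i, t i • evalDual S (l i) z := by
  induction z with
  | zero => simp
  | add x y hx hy => simp only [map_add, hx, hy, smul_add, Finset.sum_add_distrib]
  | tmul r w => simp [Finset.sum_smul, smul_smul]

/-- Forms and vectors of the extended space are `k₁`-combinations of those coming from `k₂`, and a
generated `k₁`-subalgebra absorbs the scalars. -/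
lemma Generates.extendScalars [∀ X, Module.Finite k₂ (G.obj X)]
    {u : MixedIso P F (G ⋙ ModuleCat.extendScalars.{0, 0, 0} f) A} (h : u.Generates) :
    (u.trans (toExtendScalars P G f A hA).symm).Generates := by
  rw [Generates, eq_top_iff, ← h, Algebra.adjoin_le_iff]
  rintro _ (⟨X, hX, l, x, rfl⟩ | ⟨X, hX, φ, y, rfl⟩)
  · obtain ⟨t, rfl⟩ := dual_extendScalars_eq_sum l
    rw [coeff_apply, evalDual_sum_smul]
    refine Subalgebra.sum_mem (Algebra.adjoin k₁ _) fun i _ ↦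
      Subalgebra.smul_mem (Algebra.adjoin k₁ _) (Algebra.subset_adjoin ?_) _
    exact Or.inl ⟨X, hX, _, x, (extendScalars_coeff hA u X hX _ x).symm⟩
  · let := f.toAlgebra
    let y' : k₁ ⊗[k₂] G.obj X := y
    let q : k₁ ⊗[k₂] G.obj X →ₗ[k₁] A :=
      (evalDual A φ ∘ₗ (u.app X hX).symm.toLinearMap).restrictScalars k₁ ∘ₗ
        TensorProduct.mk k₁ A (k₁ ⊗[k₂] G.obj X) 1
    change q y' ∈ Algebra.adjoin k₁ _
    generalize y' = z
    induction z with
    | zero => rw [map_zero]; exact zero_mem _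
    | add x y hx hy => rw [map_add]; exact add_mem hx hy
    | tmul t y =>
      have ht : t ⊗ₜ[k₂] y = t • ((1 : k₁) ⊗ₜ[k₂] y) := by
        rw [smul_tmul', smul_eq_mul, mul_one]
      rw [ht, map_smul]
      refine Subalgebra.smul_mem (Algebra.adjoin k₁ _) (Algebra.subset_adjoin ?_) _
      exact Or.inr ⟨X, hX, φ, y, rfl⟩

end ExtendScalars

end MixedIso

/-! ### The comparison as a complex point of the torsor -/

namespace MixedIso

/-- The comparison isomorphisms of de Rham--Betti objects. -/
def comparison {K L : Type} [Field K] [Field L] [Algebra K ℂ] [Algebra L ℂ]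
    (P : ObjectProperty (DRB K L)) : MixedIso P (DRB.omegaDR K L) (DRB.omegaB K L) ℂ where
  app X _ := X.c
  naturality _ _ f a := f.comm a
  unit _ := (DRB.unitC_tmul (1 : ℂ) (1 : K)).trans (by rw [one_smul]; rfl)
  tensor X Y _ _ _ a b := by
    have h1 : tensorMul (DRB.omegaDR K L) ℂ X Y a b = bcMul K ℂ X.dR Y.dR a b :=
      LinearMap.congr_fun (LinearMap.baseChange_id (R := K) (A := ℂ) (M := X.dR ⊗[K] Y.dR)) _
    have h2 : tensorMul (DRB.omegaB K L) ℂ X Y (X.c a) (Y.c b) =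
        bcMul L ℂ X.B Y.B (X.c a) (Y.c b) :=
      LinearMap.congr_fun (LinearMap.baseChange_id (R := L) (A := ℂ) (M := X.B ⊗[L] Y.B)) _
    exact ((congrArg _ h1).trans (DRB.tensorC_bcMul X Y a b)).trans h2.symm

section

attribute [local instance] Algebra.TensorProduct.rightAlgebra

variable {k₁ k₂ : Type} [Field k₁] [Field k₂] {D : Type u} [Category.{v} D]
    [MonoidalCategory D] {P : ObjectProperty D} {F : D ⥤ ModuleCat.{0} k₁}
    {G : D ⥤ ModuleCat.{0} k₂} [F.LaxMonoidal] [G.LaxMonoidal]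
    {A : Type*} [CommRing A] [Algebra k₁ A] [Algebra k₂ A] {S : Type*} [CommRing S]
    [Algebra k₁ S] [Algebra k₂ S]

/-- For a vector with coefficients in `S`, the scalars of `S` pass through the left factor of `S ⊗
A` and the universal coefficient sits in the right one. This computes the maps between `ℂ ⊗ A` and
`ℂ ⊗ A'`. -/
lemma evalDual_baseChange_app [SMulCommClass k₁ k₂ S] [IsScalarTower k₂ A (S ⊗[k₁] A)]
    (u : MixedIso P F G A) (X : D)
    (hX : P X) (l : Module.Dual k₂ (G.obj X)) (w : S ⊗[k₁] F.obj X) :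
    evalDual (S ⊗[k₁] A) l ((u.baseChange (S ⊗[k₁] A)).app X hX
      (bc (IsScalarTower.toAlgHom k₁ S (S ⊗[k₁] A)) _ w)) =
      (u.coeff X hX l).baseChange S w := by
  induction w with
  | zero => simp
  | add x y hx hy => simp only [map_add, hx, hy]
  | tmul s x =>
    have h1 : bc (IsScalarTower.toAlgHom k₁ S (S ⊗[k₁] A)) (F.obj X) (s ⊗ₜ x) =
        (s ⊗ₜ[k₁] (1 : A)) • ((1 : S ⊗[k₁] A) ⊗ₜ[k₁] x) := by
      rw [smul_tmul', smul_eq_mul, mul_one]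
      rfl
    have h2 : (u.baseChange (S ⊗[k₁] A)).app X hX (1 ⊗ₜ x) =
        bc (IsScalarTower.toAlgHom k₂ A (S ⊗[k₁] A)) _ (u.app X hX (1 ⊗ₜ x)) :=
      baseChangeApp_tmul _ _ _
    rw [h1, map_smul, map_smul, h2, evalDual_bc, LinearMap.baseChange_tmul, coeff_apply]
    change s ⊗ₜ[k₁] (1 : A) * (1 : S) ⊗ₜ[k₁] _ = _
    rw [Algebra.TensorProduct.tmul_mul_tmul, one_mul, mul_one]

end

end MixedIso

/-! ### Connectedness from universality -/

namespace DRB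

open MixedIso

section

attribute [local instance] Algebra.TensorProduct.rightAlgebra

/-- Connectedness of the spectra of algebras with universal isomorphisms. -/
theorem connectedSpace_of_liftsTo {K L : Type} [Field K] [Field L] [Algebra K ℂ] [Algebra L ℂ]
    [Algebra L K] [IsScalarTower L K ℂ] [IsAlgClosed K] [IsGalois L K]
    {P : ObjectProperty (DRB K L)} (hP : IsTannakian P) {A A' : Type*} [CommRing A] [Algebra K A]
    [Algebra L A] [CommRing A'] [Algebra L A']
    (hA : ∀ t, algebraMap L A t = algebraMap K A (algebraMap L K t))
    {u : MixedIso P (omegaDR K L) (omegaB K L) A} {g : MixedIso P (omegaB K L) (omegaB K L) A'}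
    (hu : u.Generates) (hg : g.Generates)
    (hu₁ : ∀ h : MixedIso P (omegaDR K L) (omegaB K L) (ℂ ⊗[L] A'), u.LiftsTo h)
    (hu₂ : ∀ h : MixedIso P (omegaDR K L) (omegaB K L) ℂ, u.LiftsTo h)
    (hg₁ : ∀ h : MixedIso P (omegaB K L) (omegaB K L) (ℂ ⊗[K] A), g.LiftsTo h)
    (hg₂ : ∀ h : MixedIso P (omegaB K L) (omegaB K L) L, g.LiftsTo h) :
    ConnectedSpace (PrimeSpectrum A') ∧ ConnectedSpace (PrimeSpectrum A) := by
  -- `L` acts on `ℂ ⊗[K] A` through `ℂ` and through `A`; the two actions agree because both come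
  -- from `K`.
  have : IsScalarTower L A (ℂ ⊗[K] A) := IsScalarTower.of_algebraMap_eq fun t ↦ by
    rw [hA]
    change algebraMap L ℂ t ⊗ₜ[K] (1 : A) = (1 : ℂ) ⊗ₜ[K] algebraMap K A (algebraMap L K t)
    rw [IsScalarTower.algebraMap_apply L K ℂ, Algebra.algebraMap_eq_smul_one (A := ℂ),
      Algebra.algebraMap_eq_smul_one (A := A), smul_tmul]
  -- The comparison followed by the universal automorphism is a point of the torsor, giving `φ`; the
  -- inverse comparison followed by the universal point of the torsor is an automorphism, giving
  -- `ψ`. The comparison itself gives `p`, and the identity automorphism gives `p'`.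
  obtain ⟨φ, hφ⟩ := hu₁ (((comparison P).baseChange (ℂ ⊗[L] A')).trans (g.baseChange _))
  obtain ⟨ψ, hψ⟩ := hg₁ (((comparison P).symm.baseChange (ℂ ⊗[K] A)).trans (u.baseChange _))
  obtain ⟨p, hp⟩ := hu₂ (comparison P)
  obtain ⟨p', -⟩ := hg₂ (MixedIso.refl P (omegaB K L) L)
  let Φ : ℂ ⊗[K] A →ₐ[ℂ] ℂ ⊗[L] A' := Algebra.TensorProduct.lift (Algebra.ofId ℂ _) φ
    fun _ _ ↦ Commute.all _ _
  let Ψ : ℂ ⊗[L] A' →ₐ[ℂ] ℂ ⊗[K] A := Algebra.TensorProduct.lift (Algebra.ofId ℂ _) ψ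
    fun _ _ ↦ Commute.all _ _
  have hφ' (X : DRB K L) (hX : P X) (l : Module.Dual L X.B) (x : X.dR) :
      φ (coeffDR u X hX l x) = (coeffB g X hX l).baseChange ℂ (X.c (1 ⊗ₜ x)) := by
    refine (hφ X hX l x).trans ?_
    refine Eq.trans ?_ (g.evalDual_baseChange_app X hX l (X.c (1 ⊗ₜ x)))
    exact congrArg (fun z ↦ evalDual (ℂ ⊗[L] A') l ((g.baseChange (ℂ ⊗[L] A')).app X hX z))
      (baseChangeApp_tmul _ _ _)
  have hψ' (X : DRB K L) (hX : P X) (l : Module.Dual L X.B) (y : X.B) :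
      ψ (coeffB g X hX l y) = (coeffDR u X hX l).baseChange ℂ (X.c.symm (1 ⊗ₜ y)) := by
    refine (hψ X hX l y).trans ?_
    refine Eq.trans ?_ (u.evalDual_baseChange_app X hX l (X.c.symm (1 ⊗ₜ y)))
    exact congrArg (fun z ↦ evalDual (ℂ ⊗[K] A) l ((u.baseChange (ℂ ⊗[K] A)).app X hX z))
      (baseChangeApp_tmul _ _ _)
  have hΦ (X : DRB K L) (hX : P X) (l : Module.Dual L X.B) (z : ℂ ⊗[K] X.dR) :
      Φ ((coeffDR u X hX l).baseChange ℂ z) = (coeffB g X hX l).baseChange ℂ (X.c z) := by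
    induction z with
    | zero => simp
    | add x y hx hy => simp only [map_add, hx, hy]
    | tmul r x =>
      have h : r ⊗ₜ[K] x = r • ((1 : ℂ) ⊗ₜ[K] x) := by rw [smul_tmul', smul_eq_mul, mul_one]
      rw [h, map_smul, map_smul, map_smul, map_smul, ← hφ', LinearMap.baseChange_tmul]
      congr 1
      simp [Φ, ← Algebra.TensorProduct.one_def]
  have hΨ (X : DRB K L) (hX : P X) (l : Module.Dual L X.B) (w : ℂ ⊗[L] X.B) :
      Ψ ((coeffB g X hX l).baseChange ℂ w) = (coeffDR u X hX l).baseChange ℂ (X.c.symm w) := by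
    induction w with
    | zero => simp
    | add x y hx hy => simp only [map_add, hx, hy]
    | tmul r x =>
      have h : r ⊗ₜ[L] x = r • ((1 : ℂ) ⊗ₜ[L] x) := by rw [smul_tmul', smul_eq_mul, mul_one]
      rw [h, map_smul, map_smul, map_smul, map_smul, ← hψ', LinearMap.baseChange_tmul]
      congr 1
      simp [Ψ, ← Algebra.TensorProduct.one_def]
  exact connectedSpace_of_universal hP u g hu hg Φ Ψ hΦ
    (fun X hX l z ↦ (hΨ X hX l (X.c z)).trans (by rw [LinearEquiv.symm_apply_apply]))
    p (fun X hX l x ↦ hp X hX l x) p'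

end

end DRB

/-! ### The groups and torsors over `ℚ` and `ℚ̄` -/

open MixedIso DRB

instance : IsAlgClosed Qbar := (algebraicClosure.isAlgClosure ℚ ℂ).isAlgClosed

instance : IsGalois ℚ Qbar := by
  have h : Algebra.IsAlgebraic ℚ Qbar := (algebraicClosure.isAlgClosure ℚ ℂ).isAlgebraic
  have : IsAlgClosure ℚ Qbar := ⟨inferInstance, h⟩
  infer_instance

lemma connectedSpace_GQbardRB : ConnectedSpace GQbardRB ∧ ConnectedSpace OmegaQbardRB :=
  connectedSpace_of_liftsTo isTannakian_top (fun _ ↦ rfl)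
    (u := universal (omegaDR Qbar Qbar) (omegaB Qbar Qbar))
    (g := universal (omegaB Qbar Qbar) (omegaB Qbar Qbar))
    universal_generates universal_generates (fun h ↦ universal_liftsTo h)
    (fun h ↦ universal_liftsTo h) (fun h ↦ universal_liftsTo h) (fun h ↦ universal_liftsTo h)

lemma connectedSpace_GQbardRBOf (M : QbarDRBObj) :
    ConnectedSpace (GQbardRBOf M) ∧ ConnectedSpace (OmegaQbardRBOf M) :=
  connectedSpace_of_liftsTo (isTannakian_generated M) (fun _ ↦ rfl)
    (u := universalFull (generated M) (omegaDR Qbar Qbar) (omegaB Qbar Qbar))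
    (g := universalFull (generated M) (omegaB Qbar Qbar) (omegaB Qbar Qbar))
    (universalFull_generates _) (universalFull_generates _) (fun h ↦ universalFull_liftsTo _ h)
    (fun h ↦ universalFull_liftsTo _ h) (fun h ↦ universalFull_liftsTo _ h)
    (fun h ↦ universalFull_liftsTo _ h)

lemma algebraMap_rat_eq {R : Type*} [CommRing R] [Algebra Qbar R] [Algebra ℚ R] (t : ℚ) :
    algebraMap ℚ R t = algebraMap Qbar R (algebraMap ℚ Qbar t) :=
  RingHom.congr_fun (Subsingleton.elim (algebraMap ℚ R)
    ((algebraMap Qbar R).comp (algebraMap ℚ Qbar))) t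

/-- The torsor is defined with `ω_B ⊗ ℚ̄`; its universal isomorphism is composed with the inverse of
the canonical one so that the target becomes `ω_B` over `ℚ`. -/
lemma connectedSpace_GdRB : ConnectedSpace GdRB ∧ ConnectedSpace OmegadRB :=
  connectedSpace_of_liftsTo isTannakian_top algebraMap_rat_eq
    (u := (universal (omegaDR Qbar ℚ) omegaBQbar).trans
      (toExtendScalars _ (omegaB Qbar ℚ) _ _ algebraMap_rat_eq).symm)
    (g := universal (omegaB Qbar ℚ) (omegaB Qbar ℚ))
    (universal_generates.extendScalars _) universal_generates
    (fun h ↦ LiftsTo.extendScalars _ algebraMap_rat_eq h (universal_liftsTo _))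
    (fun h ↦ LiftsTo.extendScalars _ algebraMap_rat_eq h (universal_liftsTo _))
    (fun h ↦ universal_liftsTo h) (fun h ↦ universal_liftsTo h)

lemma connectedSpace_GdRBOf (M : DRBObj) :
    ConnectedSpace (GdRBOf M) ∧ ConnectedSpace (OmegadRBOf M) :=
  connectedSpace_of_liftsTo (isTannakian_generated M) algebraMap_rat_eq
    (u := (universalFull (generated M) (omegaDR Qbar ℚ) omegaBQbar).trans
      (toExtendScalars _ (omegaB Qbar ℚ) _ _ algebraMap_rat_eq).symm)
    (g := universalFull (generated M) (omegaB Qbar ℚ) (omegaB Qbar ℚ))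
    ((universalFull_generates _).extendScalars _) (universalFull_generates _)
    (fun h ↦ LiftsTo.extendScalars _ algebraMap_rat_eq h (universalFull_liftsTo _ _))
    (fun h ↦ LiftsTo.extendScalars _ algebraMap_rat_eq h (universalFull_liftsTo _ _))
    (fun h ↦ universalFull_liftsTo _ h) (fun h ↦ universalFull_liftsTo _ h)

end

end DeRhamBetti

theorem theoremT :
    (ConnectedSpace DeRhamBetti.GdRB ∧
      ConnectedSpace DeRhamBetti.OmegadRB ∧
      ∀ M : DeRhamBetti.DRBObj,
        ConnectedSpace (DeRhamBetti.GdRBOf M) ∧ ConnectedSpace (DeRhamBetti.OmegadRBOf M)) ∧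
    (ConnectedSpace DeRhamBetti.GQbardRB ∧
      ConnectedSpace DeRhamBetti.OmegaQbardRB ∧
      ∀ M : DeRhamBetti.QbarDRBObj,
        ConnectedSpace (DeRhamBetti.GQbardRBOf M) ∧
          ConnectedSpace (DeRhamBetti.OmegaQbardRBOf M)) :=
  ⟨⟨DeRhamBetti.connectedSpace_GdRB.1, DeRhamBetti.connectedSpace_GdRB.2,
    DeRhamBetti.connectedSpace_GdRBOf⟩,
    DeRhamBetti.connectedSpace_GQbardRB.1, DeRhamBetti.connectedSpace_GQbardRB.2,
    DeRhamBetti.connectedSpace_GQbardRBOf⟩
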